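/- Let $P=\mathbb{Z}\rtimes\mathbb{N}^\times$ be the left cancellative monoid of pairs $(k,a)$, $k\in\mathbb{Z}$, $a\in\mathbb{N}^\times=\{1,2,3,\dots\}$, with $(k,a)(l,b)=(k+al,ab)$, and let $P^*=\mathbb{Z}\times\{1\}$ be its group of invertible elements. Let $I_l$ be the inverse semigroup of partial bijections of $P$ generated by the left multiplications $x\mapsto cx$, $c\in P$, and let $E$ be its semilattice of idempotents, identified with subsets of $P$. Let $\Omega$ be the space, with the topology of pointwise convergence, of nonzero semicharacters $\chi:E\to\{0,1\}$ with $\chi(f)=\bigvee_i\chi(e_i)$ whenever $f,e_1,\dots,e_n\in E$ and $f=\bigcup_i e_i$ (for $n=0$: $\chi(\emptyset)=0$ if $\emptyset\in E$). Let $\overline{E}$ be the collection of finite unions of sets $e\setminus(f_1\cup\dots\cup f_k)$ with $e,f_j\in E$, $f_j\subseteq e$; every $\chi\in\Omega$ extends canonically to $\overline{E}$. Let $\overline{I}_l$ be the inverse semigroup of all restrictions $s|_A$ with $s\in I_l$, $A\in\overline{E}$, $A\subseteq\operatorname{dom}(s)$. It acts on $\Omega$ by $(s\cdot\chi)(e)=\chi(s^{-1}es)$,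 for $\chi$ with $\chi(s^{-1}s)=1$. Let $\mathscr{G}=\overline{I}_l\ltimes\Omega$ be the groupoid of germs $[s,\chi]$, $\chi(s^{-1}s)=1$, where $[s,\chi]=[t,\chi]$ if and only if $se=te$ for some idempotent $e$ with $\chi(e)=1$; the source of $[s,\chi]$ is $\chi$, the target is $s\cdot\chi$, the product is $[s,t\cdot\chi][t,\chi]=[st,\chi]$, and the topology is generated by the sets $[s,U]=\{[s,\chi]:\chi\in U\}$ with $U$ open in $\{\chi\in\Omega:\chi(s^{-1}s)=1\}$. Let $\operatorname{Iso}(\mathscr{G})$ be the set of elements whose source and target coincide, and let $P^*\ltimes\Omega=\{[u,\chi]:u\in P^*,\ \chi\in\Omega\}$. For an open subgroupoid $H$ of $\mathscr{G}$, regard $C^*_r(H)$ as a $C^*$-subalgebra of $C^*_r(\mathscr{G})$. A $C^*$-subalgebra $B$ of a $C^*$-algebra $A$ detects ideals in $A$ if the only closed two-sided ideal $J$ of $A$ with $B\cap J=\{0\}$ is $J=\{0\}$. Then the following hold. 1. The interior of the isotropy is the unit space: $\operatorname{Iso}(\mathscr{G})^\circ=\mathscr{G}^{(0)}=\Omega$.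 2. $\operatorname{Iso}(\mathscr{G})^\circ\subsetneq P^*\ltimes\Omega$. 3. The interior of the isotropy gives the more efficient ideal detection: both $C^*_r(\operatorname{Iso}(\mathscr{G})^\circ)$ and $C^*_r(P^*\ltimes\Omega)$ detect ideals in $C^*_r(\mathscr{G})$, and $C^*_r(\operatorname{Iso}(\mathscr{G})^\circ)\subsetneq C^*_r(P^*\ltimes\Omega)$. -/

import Mathlib

open Set Topology

noncomputable section

namespace LeftCancellative

universe u

/-! ### Partial bijections and the left inverse hull -/

/-- The domain of a partial bijection. -/
def dom {X : Type u} (s : X ≃. X) : Set X := {x | ∃ y, y ∈ s x}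

open Classical in
/-- The idempotent partial bijection (the partial identity) attached to a subset. -/
def partialId {X : Type u} (A : Set X) : X ≃. X := PEquiv.ofSet A

/-- The product `s t` in the symmetric inverse monoid: first `t`, then `s`. -/
def pmul {X : Type u} (s t : X ≃. X) : X ≃. X := t.trans s

/-- The subset of `X` whose partial identity is `s⁻¹ A s`, that is, the preimage of `A` under `s`. -/
def pull {X : Type u} (s : X ≃. X) (A : Set X) : Set X := {x | ∃ y ∈ A, y ∈ s x}

theorem mem_partialId {X : Type u} {A : Set X} {x y : X} :
    y ∈ partialId A x ↔ y = x ∧ x ∈ A := by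
  classical
  unfold partialId
  rw [PEquiv.mem_ofSet_iff]
  constructor
  · rintro ⟨rfl, h⟩; exact ⟨rfl, h⟩
  · rintro ⟨rfl, h⟩; exact ⟨rfl, h⟩

theorem mem_pmul {X : Type u} {s t : X ≃. X} {x z : X} :
    z ∈ pmul s t x ↔ ∃ y, y ∈ t x ∧ z ∈ s y := PEquiv.mem_trans _ _ _ _

theorem mem_unique {X : Type u} {s : X ≃. X} {x y z : X} (h : y ∈ s x) (h' : z ∈ s x) : y = z :=
  Option.mem_unique h h'

theorem pext {X : Type u} {s t : X ≃. X} (h : ∀ x y, y ∈ s x ↔ y ∈ t x) : s = t :=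
  PEquiv.ext fun x => Option.ext fun y => h x y

variable {P : Type u} [Monoid P] [IsLeftCancelMul P]

open Classical in
/-- Left multiplication `x ↦ c x`, a bijection of `P` onto `c P`. -/
def leftMul (c : P) : P ≃. P where
  toFun x := some (c * x)
  invFun y := if h : ∃ x, c * x = y then some h.choose else none
  inv x y := by
    constructor
    · intro h
      split_ifs at h with hy
      have hx : hy.choose = x := by simpa using h
      rw [← hx, hy.choose_spec]
    · intro h
      have hxy : c * x = y := by simpa using h
      have hy : ∃ x, c * x = y := ⟨x, hxy⟩
      rw [dif_pos hy]
      exact congrArg some (mul_left_cancel (hy.choose_spec.trans hxy.symm))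

theorem mem_leftMul {c x y : P} : y ∈ leftMul c x ↔ y = c * x := by
  change some (c * x) = some y ↔ _
  rw [Option.some_inj, eq_comm]

/-- The left inverse hull `I_l`: the inverse subsemigroup of the symmetric inverse monoid of `P`
generated by the left multiplications. -/
inductive InHull : (P ≃. P) → Prop
  | leftMul (c : P) : InHull (leftMul c)
  | mul {s t : P ≃. P} : InHull s → InHull t → InHull (pmul s t)
  | inv {s : P ≃. P} : InHull s → InHull s.symm

variable (P) in
/-- The semilattice `E` of idempotents of the left inverse hull, as subsets of `P`. -/
def E : Set (Set P) := {A | InHull (partialId A)}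

theorem dom_mem_E {s : P ≃. P} (hs : InHull s) : dom s ∈ E P := by
  have : partialId (dom s) = pmul s.symm s := by
    apply pext
    intro x y
    rw [mem_partialId, mem_pmul]
    constructor
    · rintro ⟨rfl, z, hz⟩
      exact ⟨z, hz, (PEquiv.mem_iff_mem s).2 hz⟩
    · rintro ⟨z, hz, hy⟩
      exact ⟨s.inj ((PEquiv.mem_iff_mem s).1 hy) hz, z, hz⟩
  change InHull _
  rw [this]
  exact .mul (.inv hs) hs

theorem univ_mem_E : (univ : Set P) ∈ E P := by
  have : dom (leftMul (1 : P)) = univ := by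
    ext x; simp only [dom, mem_leftMul, mem_ofPred_eq, exists_eq, mem_univ]
  rw [← this]
  exact dom_mem_E (.leftMul 1)

theorem pull_mem_E {s : P ≃. P} (hs : InHull s) {A : Set P} (hA : A ∈ E P) : pull s A ∈ E P := by
  have : pull s A = dom (pmul (partialId A) s) := by
    ext x
    simp only [pull, dom, mem_pmul, mem_partialId, mem_ofPred_eq]
    constructor
    · rintro ⟨y, hy, h⟩; exact ⟨y, y, h, rfl, hy⟩
    · rintro ⟨y, z, h, rfl, hz⟩; exact ⟨y, hz, h⟩
  rw [this]
  exact dom_mem_E (.mul hA hs)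

theorem inter_mem_E {A B : Set P} (hA : A ∈ E P) (hB : B ∈ E P) : A ∩ B ∈ E P := by
  have : A ∩ B = pull (partialId A) B := by
    ext x
    simp only [pull, mem_partialId, mem_inter_iff, mem_ofPred_eq]
    constructor
    · rintro ⟨h, h'⟩; exact ⟨x, h', rfl, h⟩
    · rintro ⟨y, h', rfl, h⟩; exact ⟨h, h'⟩
  rw [this]
  exact pull_mem_E hA hB

/-! ### The Boolean closure of `E` and the enlarged hull -/

/-- `S` is a finite collection of pairs `(e, F)` with `e ∈ E`, and `F ⊆ E` a finite set of
elements below `e`; it represents the set `⋃ (e \ ⋃ F)`. -/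
def IsRep (S : Set (Set P × Set (Set P))) : Prop :=
  S.Finite ∧ ∀ p ∈ S, p.1 ∈ E P ∧ p.2.Finite ∧ ∀ f ∈ p.2, f ∈ E P ∧ f ⊆ p.1

/-- The subset `⋃ (e \ ⋃ F)` represented by `S`. -/
def repSet (S : Set (Set P × Set (Set P))) : Set P := ⋃ p ∈ S, p.1 \ ⋃₀ p.2

variable (P) in
/-- The Boolean closure of `E`. -/
def Ebar : Set (Set P) := {A | ∃ S, IsRep S ∧ A = repSet S}

/-- The enlarged left inverse hull: restrictions of elements `s` of the left inverse hull to
elements of the Boolean closure contained in the domain of `s`. -/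
def InHullBar (s : P ≃. P) : Prop :=
  ∃ t A, InHull t ∧ A ∈ Ebar P ∧ A ⊆ dom t ∧ s = pmul t (partialId A)

theorem mem_repSet {S : Set (Set P × Set (Set P))} {x : P} :
    x ∈ repSet S ↔ ∃ p ∈ S, x ∈ p.1 ∧ ∀ f ∈ p.2, x ∉ f := by
  simp only [repSet, mem_iUnion, mem_sdiff, mem_sUnion, exists_prop, not_exists, not_and]

theorem E_subset_Ebar {A : Set P} (hA : A ∈ E P) : A ∈ Ebar P := by
  refine ⟨{(A, ∅)}, ⟨finite_singleton _, ?_⟩, ?_⟩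
  · rintro p rfl
    exact ⟨hA, finite_empty, by simp⟩
  · simp [repSet]

theorem inter_mem_Ebar {A B : Set P} (hA : A ∈ Ebar P) (hB : B ∈ Ebar P) : A ∩ B ∈ Ebar P := by
  obtain ⟨S, hS, rfl⟩ := hA
  obtain ⟨T, hT, rfl⟩ := hB
  refine ⟨image2 (fun p q => (p.1 ∩ q.1, (q.1 ∩ ·) '' p.2 ∪ (p.1 ∩ ·) '' q.2)) S T,
    ⟨hS.1.image2 _ hT.1, ?_⟩, ?_⟩
  · rintro _ ⟨p, hp, q, hq, rfl⟩
    obtain ⟨hp1, hp2, hp3⟩ := hS.2 p hp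
    obtain ⟨hq1, hq2, hq3⟩ := hT.2 q hq
    refine ⟨inter_mem_E hp1 hq1, (hp2.image _).union (hq2.image _), ?_⟩
    rintro _ (⟨f, hf, rfl⟩ | ⟨f, hf, rfl⟩)
    · exact ⟨inter_mem_E hq1 (hp3 f hf).1, fun x hx => ⟨(hp3 f hf).2 hx.2, hx.1⟩⟩
    · exact ⟨inter_mem_E hp1 (hq3 f hf).1, fun x hx => ⟨hx.1, (hq3 f hf).2 hx.2⟩⟩
  · ext x
    rw [mem_inter_iff, mem_repSet, mem_repSet, mem_repSet]
    constructor
    · rintro ⟨⟨p, hp, h1, h2⟩, q, hq, h3, h4⟩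
      refine ⟨_, ⟨p, hp, q, hq, rfl⟩, ⟨h1, h3⟩, ?_⟩
      rintro _ (⟨f, hf, rfl⟩ | ⟨f, hf, rfl⟩)
      · exact fun h => h2 f hf h.2
      · exact fun h => h4 f hf h.2
    · rintro ⟨_, ⟨p, hp, q, hq, rfl⟩, ⟨h1, h3⟩, h⟩
      exact ⟨⟨p, hp, h1, fun f hf hx => h _ (.inl ⟨f, hf, rfl⟩) ⟨h3, hx⟩⟩,
        q, hq, h3, fun f hf hx => h _ (.inr ⟨f, hf, rfl⟩) ⟨h1, hx⟩⟩

theorem pull_mem_Ebar_of_hull {t : P ≃. P} (ht : InHull t) {A : Set P} (hA : A ∈ Ebar P) :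
    pull t A ∈ Ebar P := by
  obtain ⟨S, hS, rfl⟩ := hA
  refine ⟨(fun p => (pull t p.1, pull t '' p.2)) '' S, ⟨hS.1.image _, ?_⟩, ?_⟩
  · rintro _ ⟨p, hp, rfl⟩
    obtain ⟨h1, h2, h3⟩ := hS.2 p hp
    refine ⟨pull_mem_E ht h1, h2.image _, ?_⟩
    rintro _ ⟨f, hf, rfl⟩
    exact ⟨pull_mem_E ht (h3 f hf).1, fun x ⟨y, hy, hxy⟩ => ⟨y, (h3 f hf).2 hy, hxy⟩⟩
  · ext x
    rw [mem_repSet]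
    constructor
    · rintro ⟨y, hy, hxy⟩
      obtain ⟨p, hp, h1, h2⟩ := mem_repSet.1 hy
      refine ⟨_, ⟨p, hp, rfl⟩, ⟨y, h1, hxy⟩, ?_⟩
      rintro _ ⟨f, hf, rfl⟩ ⟨z, hz, hxz⟩
      exact h2 f hf (mem_unique hxz hxy ▸ hz)
    · rintro ⟨_, ⟨p, hp, rfl⟩, ⟨y, h1, hxy⟩, h2⟩
      exact ⟨y, mem_repSet.2 ⟨p, hp, h1, fun f hf hy => h2 _ ⟨f, hf, rfl⟩ ⟨y, hy, hxy⟩⟩, hxy⟩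

theorem pull_mem_Ebar {s : P ≃. P} (hs : InHullBar s) {A : Set P} (hA : A ∈ Ebar P) :
    pull s A ∈ Ebar P := by
  obtain ⟨t, B, ht, hB, -, rfl⟩ := hs
  have : pull (pmul t (partialId B)) A = B ∩ pull t A := by
    ext x
    simp only [pull, mem_pmul, mem_partialId, mem_inter_iff, mem_ofPred_eq]
    constructor
    · rintro ⟨y, hy, z, ⟨rfl, hz⟩, h⟩; exact ⟨hz, y, hy, h⟩
    · rintro ⟨hz, y, hy, h⟩; exact ⟨y, hy, x, ⟨rfl, hz⟩, h⟩
  rw [this]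
  exact inter_mem_Ebar hB (pull_mem_Ebar_of_hull ht hA)

theorem dom_eq_pull {X : Type u} (s : X ≃. X) : dom s = pull s univ := by
  ext x; simp [dom, pull]

theorem dom_mem_Ebar {s : P ≃. P} (hs : InHullBar s) : dom s ∈ Ebar P := by
  rw [dom_eq_pull]
  exact pull_mem_Ebar hs (E_subset_Ebar univ_mem_E)

theorem hullBar_of_hull {s : P ≃. P} (hs : InHull s) : InHullBar s := by
  refine ⟨s, dom s, hs, E_subset_Ebar (dom_mem_E hs), Subset.rfl, pext fun x y => ?_⟩
  rw [mem_pmul]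
  simp only [mem_partialId]
  constructor
  · intro h; exact ⟨x, ⟨rfl, y, h⟩, h⟩
  · rintro ⟨z, ⟨rfl, -⟩, h⟩; exact h

theorem hullBar_mul {s t : P ≃. P} (hs : InHullBar s) (ht : InHullBar t) :
    InHullBar (pmul s t) := by
  have ht' := ht
  obtain ⟨s, A, hs, hA, hAs, rfl⟩ := hs
  obtain ⟨t, B, ht, hB, hBt, rfl⟩ := ht
  refine ⟨pmul s t, pull (pmul t (partialId B)) A, .mul hs ht, pull_mem_Ebar ht' hA, ?_, ?_⟩
  · rintro x ⟨y, hy, hxy⟩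
    obtain ⟨z, hz⟩ := hAs hy
    obtain ⟨w, hw, hwy⟩ := mem_pmul.1 hxy
    obtain ⟨rfl, hw⟩ := mem_partialId.1 hw
    exact ⟨z, mem_pmul.2 ⟨y, hwy, hz⟩⟩
  · apply pext
    intro x z
    simp only [mem_pmul, mem_partialId, pull, mem_ofPred_eq]
    constructor
    · rintro ⟨y, ⟨w, ⟨rfl, hw⟩, hwy⟩, v, ⟨rfl, hv⟩, h⟩
      exact ⟨w, ⟨rfl, v, hv, w, ⟨rfl, hw⟩, hwy⟩, v, hwy, h⟩
    · rintro ⟨w, ⟨rfl, y, hy, v, ⟨rfl, hv⟩, hvy⟩, y', hy', h⟩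
      obtain rfl := mem_unique hvy hy'
      exact ⟨y, ⟨v, ⟨rfl, hv⟩, hvy⟩, y, ⟨rfl, hy⟩, h⟩

theorem hullBar_inv {s : P ≃. P} (hs : InHullBar s) : InHullBar s.symm := by
  obtain ⟨s, A, hs, hA, hAs, rfl⟩ := hs
  refine ⟨s.symm, pull s.symm A, .inv hs, pull_mem_Ebar_of_hull (.inv hs) hA, ?_, ?_⟩
  · rintro x ⟨y, hy, hxy⟩; exact ⟨y, hxy⟩
  · apply pext
    intro x y
    rw [PEquiv.mem_iff_mem]
    simp only [mem_pmul, mem_partialId, pull, mem_ofPred_eq]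
    constructor
    · rintro ⟨z, ⟨rfl, hz⟩, h⟩
      have h' := (PEquiv.mem_iff_mem s).2 h
      exact ⟨x, ⟨rfl, z, hz, h'⟩, h'⟩
    · rintro ⟨z, ⟨rfl, w, hw, hzw⟩, h⟩
      obtain rfl := mem_unique hzw h
      exact ⟨w, ⟨rfl, hw⟩, (PEquiv.mem_iff_mem s).1 h⟩

variable (P) in
/-- The enlarged left inverse hull as a type. -/
def HullBar : Type u := {s : P ≃. P // InHullBar s}

/-- The product of the inverse semigroup `HullBar P`. -/
def HullBar.mul (s t : HullBar P) : HullBar P := ⟨pmul s.1 t.1, hullBar_mul s.2 t.2⟩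

/-- The inverse of the inverse semigroup `HullBar P`. -/
def HullBar.inv (s : HullBar P) : HullBar P := ⟨s.1.symm, hullBar_inv s.2⟩

/-- An element of `P`, viewed in the hull as left multiplication. -/
def HullBar.of (c : P) : HullBar P := ⟨leftMul c, hullBar_of_hull (.leftMul c)⟩

/-! ### The space of characters -/

/-- The conditions defining `Ω`: `χ` is a nonzero semicharacter on `E` which preserves all finite
suprema that exist (the empty one included, so that `χ` vanishes at zero if zero is in `E`). -/
structure IsOmega (χ : E P → Bool) : Prop where
  nonzero : ∃ e, χ e = true
  map_inf : ∀ e f g : E P, g.1 = e.1 ∩ f.1 → χ g = (χ e && χ f)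
  map_sup : ∀ (f : E P) (S : Finset (E P)), f.1 = ⋃ e ∈ S, e.1 →
    (χ f = true ↔ ∃ e ∈ S, χ e = true)

variable (P) in
/-- The space `Ω`, with the topology of pointwise convergence. -/
def Omega : Type u := {χ : E P → Bool // IsOmega χ}

instance : TopologicalSpace (Omega P) := inferInstanceAs (TopologicalSpace {χ // IsOmega χ})

/-- `χ(e) = 1`, for a subset `e` of `P` in `E`. -/
def Omega.On (χ : Omega P) (e : Set P) : Prop := ∃ h : e ∈ E P, χ.1 ⟨e, h⟩ = true

/-- The value at `A` of the extension of `χ` to the Boolean closure is `1`: for a representation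
`A = ⋃ (e \ ⋃ F)`, the join of the `χ(e) \ ⋁ χ(f)` is `1`. It does not depend on the
representation, see `onBar_iff`. -/
def Omega.OnBar (χ : Omega P) (A : Set P) : Prop :=
  ∃ S, IsRep S ∧ A = repSet S ∧ ∃ p ∈ S, χ.On p.1 ∧ ∀ f ∈ p.2, ¬ χ.On f

theorem Omega.on_univ (χ : Omega P) : χ.On univ := by
  obtain ⟨e, he⟩ := χ.2.nonzero
  have := χ.2.map_inf e ⟨univ, univ_mem_E⟩ e (by simp)
  rw [he] at this
  exact ⟨univ_mem_E, by simpa using this.symm⟩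

theorem Omega.on_inter (χ : Omega P) {A B : Set P} (hA : A ∈ E P) (hB : B ∈ E P) :
    χ.On (A ∩ B) ↔ χ.On A ∧ χ.On B := by
  have := χ.2.map_inf ⟨A, hA⟩ ⟨B, hB⟩ ⟨A ∩ B, inter_mem_E hA hB⟩ rfl
  simp only [Omega.On, hA, hB, inter_mem_E hA hB, exists_true_left, this, Bool.and_eq_true]

theorem Omega.on_sup (χ : Omega P) {f : Set P} (hf : f ∈ E P) {S : Set (Set P)} (hS : S.Finite)
    (hSE : S ⊆ E P) (h : f = ⋃₀ S) : χ.On f ↔ ∃ e ∈ S, χ.On e := by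
  classical
  have hfin : {e : E P | e.1 ∈ S}.Finite := hS.preimage Subtype.val_injective.injOn
  have := χ.2.map_sup ⟨f, hf⟩ hfin.toFinset (by
    refine h.trans ?_
    ext x
    simp only [mem_sUnion, mem_iUnion, Finite.mem_toFinset, mem_ofPred_eq]
    constructor
    · rintro ⟨e, he, hx⟩; exact ⟨⟨e, hSE he⟩, he, hx⟩
    · rintro ⟨e, he, hx⟩; exact ⟨e.1, he, hx⟩)
  constructor
  · rintro ⟨_, h'⟩
    obtain ⟨e, he, hχ⟩ := this.1 h'
    exact ⟨e.1, by simpa using he, e.2, hχ⟩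
  · rintro ⟨e, he, hE, hχ⟩
    exact ⟨hf, this.2 ⟨⟨e, hE⟩, by simpa using he, hχ⟩⟩

/-- On finitely many elements of `E`, a point of `Ω` agrees with evaluation at a point of `P`. -/
theorem Omega.exists_agree (χ : Omega P) {S : Set (Set P)} (hS : S.Finite) (hSE : S ⊆ E P) :
    ∃ c, ∀ e ∈ S, χ.On e ↔ c ∈ e := by
  have key : ∀ T : Set (Set P), T.Finite → T ⊆ {e | e ∈ E P ∧ χ.On e} →
      ⋂₀ T ∈ E P ∧ χ.On (⋂₀ T) := by
    intro T hT
    induction T, hT using Set.Finite.induction_on with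
    | empty => intro _; rw [sInter_empty]; exact ⟨univ_mem_E, χ.on_univ⟩
    | insert _ _ ih =>
      intro h
      rw [insert_subset_iff] at h
      obtain ⟨h1, h2⟩ := ih h.2
      rw [sInter_insert]
      exact ⟨inter_mem_E h.1.1 h1, (χ.on_inter h.1.1 h1).2 ⟨h.1.2, h2⟩⟩
  obtain ⟨h1, h2⟩ := key {e | e ∈ S ∧ χ.On e} (hS.subset fun e he => he.1)
    fun e he => ⟨hSE he.1, he.2⟩
  set e0 := ⋂₀ {e | e ∈ S ∧ χ.On e} with he0
  by_contra hc
  push Not at hc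
  set F := (e0 ∩ ·) '' {e | e ∈ S ∧ ¬ χ.On e} with hF
  have hFE : F ⊆ E P := by
    rintro _ ⟨e, he, rfl⟩; exact inter_mem_E h1 (hSE he.1)
  have hcov : e0 = ⋃₀ F := by
    ext c
    constructor
    · intro hce
      obtain ⟨e, he, h⟩ := hc c
      rcases h with ⟨h, h'⟩ | ⟨h, h'⟩
      · exact absurd (hce e ⟨he, h⟩) h'
      · exact ⟨_, ⟨e, ⟨he, h⟩, rfl⟩, hce, h'⟩
    · rintro ⟨_, ⟨e, he, rfl⟩, h⟩; exact h.1
  obtain ⟨_, ⟨e, he, rfl⟩, h⟩ := (χ.on_sup h1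
    ((hS.subset (fun e he => he.1 : {e | e ∈ S ∧ ¬ χ.On e} ⊆ S)).image _) hFE hcov).1 h2
  exact he.2 ((χ.on_inter h1 (hSE he.1)).1 h).2

/-- All members of `E` that occur in a representation. -/
def repSupp (S : Set (Set P × Set (Set P))) : Set (Set P) := ⋃ p ∈ S, insert p.1 p.2

theorem IsRep.supp {S : Set (Set P × Set (Set P))} (hS : IsRep S) :
    (repSupp S).Finite ∧ repSupp S ⊆ E P := by
  refine ⟨hS.1.biUnion fun p hp => (hS.2 p hp).2.1.insert _, ?_⟩
  refine iUnion₂_subset fun p hp => insert_subset (hS.2 p hp).1 fun f hf => ((hS.2 p hp).2.2 f hf).1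

theorem rep_agree {χ : Omega P} {S : Set (Set P × Set (Set P))} {c : P}
    (h : ∀ e ∈ repSupp S, χ.On e ↔ c ∈ e) :
    (∃ p ∈ S, χ.On p.1 ∧ ∀ f ∈ p.2, ¬ χ.On f) ↔ c ∈ repSet S := by
  rw [mem_repSet]
  refine exists_congr fun p => and_congr_right fun hp => ?_
  refine and_congr (h _ (mem_biUnion hp (mem_insert _ _))) (forall₂_congr fun f hf => ?_)
  rw [h _ (mem_biUnion hp (mem_insert_of_mem _ hf))]

/-- The extension of `χ` does not depend on the representation. -/
theorem Omega.onBar_iff (χ : Omega P) {S : Set (Set P × Set (Set P))} (hS : IsRep S) :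
    χ.OnBar (repSet S) ↔ ∃ p ∈ S, χ.On p.1 ∧ ∀ f ∈ p.2, ¬ χ.On f := by
  refine ⟨?_, fun h => ⟨S, hS, rfl, h⟩⟩
  rintro ⟨T, hT, hST, h⟩
  obtain ⟨c, hc⟩ := χ.exists_agree (hS.supp.1.union hT.supp.1) (union_subset hS.supp.2 hT.supp.2)
  rw [rep_agree fun e he => hc e (.inr he), ← hST] at h
  rwa [rep_agree fun e he => hc e (.inl he)]

theorem Omega.onBar_E (χ : Omega P) {A : Set P} (hA : A ∈ E P) : χ.OnBar A ↔ χ.On A := by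
  have hS : IsRep ({(A, ∅)} : Set (Set P × Set (Set P))) :=
    ⟨finite_singleton _, by rintro p rfl; exact ⟨hA, finite_empty, by simp⟩⟩
  have := χ.onBar_iff hS
  simpa [repSet] using this

/-- On finitely many elements of the Boolean closure, a point of `Ω` agrees with evaluation at a
point of `P`. -/
theorem Omega.exists_agreeBar (χ : Omega P) {T : Set (Set P)} (hT : T.Finite) (hTE : T ⊆ Ebar P) :
    ∃ c, ∀ A ∈ T, χ.OnBar A ↔ c ∈ A := by
  choose! R hR hR' using fun A (hA : A ∈ T) => hTE hA
  obtain ⟨c, hc⟩ := χ.exists_agree (S := ⋃ A ∈ T, repSupp (R A))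
    (hT.biUnion fun A hA => (hR A hA).supp.1) (iUnion₂_subset fun A hA => (hR A hA).supp.2)
  refine ⟨c, fun A hA => ?_⟩
  conv_lhs => rw [hR' A hA]
  conv_rhs => rw [hR' A hA]
  rw [χ.onBar_iff (hR A hA), rep_agree fun e he => hc e (mem_biUnion hA he)]

/-! ### The action on the space of characters -/

open Classical in
/-- The character `s · χ`, given by `(s · χ)(e) = χ(s⁻¹ e s)`, for `χ` with `χ(s⁻¹ s) = 1`. -/
def act (s : HullBar P) (χ : Omega P) (h : χ.OnBar (dom s.1)) : Omega P :=
  ⟨fun e => decide (χ.OnBar (pull s.1 e.1)), by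
    refine ⟨⟨⟨univ, univ_mem_E⟩, ?_⟩, ?_, ?_⟩
    · rw [decide_eq_true_iff, ← dom_eq_pull]; exact h
    · intro e f g hg
      obtain ⟨c, hc⟩ := χ.exists_agreeBar (T := {pull s.1 e.1, pull s.1 f.1, pull s.1 g.1})
        (by simp) (by
          simp only [insert_subset_iff, singleton_subset_iff]
          exact ⟨pull_mem_Ebar s.2 (E_subset_Ebar e.2), pull_mem_Ebar s.2 (E_subset_Ebar f.2),
            pull_mem_Ebar s.2 (E_subset_Ebar g.2)⟩)
      rw [← Bool.decide_and, decide_eq_decide, hc _ (by simp), hc _ (by simp), hc _ (by simp), hg]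
      constructor
      · rintro ⟨y, hy, h'⟩; exact ⟨⟨y, hy.1, h'⟩, y, hy.2, h'⟩
      · rintro ⟨⟨y, hy, h'⟩, z, hz, h''⟩
        obtain rfl := mem_unique h' h''
        exact ⟨y, ⟨hy, hz⟩, h'⟩
    · intro f S hf
      obtain ⟨c, hc⟩ := χ.exists_agreeBar
        (T := insert (pull s.1 f.1) ((fun e : E P => pull s.1 e.1) '' (S : Set (E P))))
        ((S.finite_toSet.image _).insert _) (by
          refine insert_subset (pull_mem_Ebar s.2 (E_subset_Ebar f.2)) ?_
          rintro _ ⟨e, _, rfl⟩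
          exact pull_mem_Ebar s.2 (E_subset_Ebar e.2))
      rw [decide_eq_true_iff, hc _ (mem_insert _ _), hf]
      constructor
      · rintro ⟨y, hy, h'⟩
        simp only [mem_iUnion] at hy
        obtain ⟨e, he, hy⟩ := hy
        refine ⟨e, he, ?_⟩
        rw [decide_eq_true_iff, hc _ (mem_insert_of_mem _ ⟨e, he, rfl⟩)]
        exact ⟨y, hy, h'⟩
      · rintro ⟨e, he, h'⟩
        rw [decide_eq_true_iff, hc _ (mem_insert_of_mem _ ⟨e, he, rfl⟩)] at h'
        obtain ⟨y, hy, h'⟩ := h'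
        exact ⟨y, by simp only [mem_iUnion]; exact ⟨e, he, hy⟩, h'⟩⟩

theorem act_on {s : HullBar P} {χ : Omega P} {h : χ.OnBar (dom s.1)} {e : Set P} (he : e ∈ E P) :
    (act s χ h).On e ↔ χ.OnBar (pull s.1 e) := by
  classical
  simp [Omega.On, act, he]

theorem omega_ext {χ ψ : Omega P} (h : ∀ e ∈ E P, χ.On e ↔ ψ.On e) : χ = ψ := by
  apply Subtype.ext
  funext e
  have := h e.1 e.2
  simp only [Omega.On, e.2, exists_true_left] at this
  exact Bool.eq_iff_iff.2 this

/-- The formula `(s · χ)(A) = χ(s⁻¹ A s)` persists on the Boolean closure. -/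
theorem act_onBar {s : HullBar P} {χ : Omega P} {h : χ.OnBar (dom s.1)} {A : Set P}
    (hA : A ∈ Ebar P) : (act s χ h).OnBar A ↔ χ.OnBar (pull s.1 A) := by
  have hA' := hA
  obtain ⟨S, hS, rfl⟩ := hA
  rw [Omega.onBar_iff _ hS]
  obtain ⟨c, hc⟩ := χ.exists_agreeBar
    (T := insert (dom s.1) (insert (pull s.1 (repSet S)) (pull s.1 '' repSupp S)))
    (((hS.supp.1.image _).insert _).insert _) (by
      refine insert_subset (dom_mem_Ebar s.2) (insert_subset (pull_mem_Ebar s.2 hA') ?_)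
      rintro _ ⟨e, he, rfl⟩
      exact pull_mem_Ebar s.2 (E_subset_Ebar (hS.supp.2 he)))
  obtain ⟨y, hy⟩ := (hc _ (mem_insert _ _)).1 h
  have hiff : ∀ B, c ∈ pull s.1 B ↔ y ∈ B := fun B =>
    ⟨fun ⟨z, hz, h'⟩ => mem_unique h' hy ▸ hz, fun hB => ⟨y, hB, hy⟩⟩
  rw [hc _ (mem_insert_of_mem _ (mem_insert _ _)), hiff]
  apply rep_agree
  intro e he
  rw [act_on (hS.supp.2 he),
    hc _ (mem_insert_of_mem _ (mem_insert_of_mem _ ⟨e, he, rfl⟩)), hiff]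

/-! ### The transformation groupoid -/

variable (P) in
/-- Pairs `(s, χ)` with `χ(s⁻¹ s) = 1`. -/
structure PreGerm : Type u where
  s : HullBar P
  χ : Omega P
  h : χ.OnBar (dom s.1)

/-- `(s, χ) ∼ (t, χ)` if `s e = t e` for some idempotent `e` with `χ(e) = 1`. -/
def PreGerm.Rel (p q : PreGerm P) : Prop :=
  p.χ = q.χ ∧ ∃ A ∈ Ebar P, p.χ.OnBar A ∧ pmul p.s.1 (partialId A) = pmul q.s.1 (partialId A)

theorem pmul_partialId_eq {X : Type u} {s t : X ≃. X} {A : Set X} :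
    pmul s (partialId A) = pmul t (partialId A) ↔ ∀ x ∈ A, ∀ y, y ∈ s x ↔ y ∈ t x := by
  have aux : ∀ (s : X ≃. X) x y, y ∈ pmul s (partialId A) x ↔ x ∈ A ∧ y ∈ s x := by
    intro s x y
    simp only [mem_pmul, mem_partialId]
    constructor
    · rintro ⟨z, ⟨rfl, hz⟩, h⟩; exact ⟨hz, h⟩
    · rintro ⟨hz, h⟩; exact ⟨x, ⟨rfl, hz⟩, h⟩
  constructor
  · intro h x hx y
    have h1 := aux s x y
    rw [h, aux] at h1
    simpa [hx] using h1.symm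
  · intro h
    refine pext fun x y => ?_
    rw [aux, aux]
    exact and_congr_right fun hx => h x hx y

theorem Omega.onBar_inter (χ : Omega P) {A B : Set P} (hA : A ∈ Ebar P) (hB : B ∈ Ebar P)
    (h : χ.OnBar A) (h' : χ.OnBar B) : χ.OnBar (A ∩ B) := by
  obtain ⟨c, hc⟩ := χ.exists_agreeBar (T := {A, B, A ∩ B}) (by simp) (by
    simp only [insert_subset_iff, singleton_subset_iff]
    exact ⟨hA, hB, inter_mem_Ebar hA hB⟩)
  rw [hc _ (by simp)] at h h' ⊢
  exact ⟨h, h'⟩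

variable (P) in
/-- The equivalence relation defining germs. -/
def germSetoid : Setoid (PreGerm P) where
  r := PreGerm.Rel
  iseqv := by
    refine ⟨fun p => ⟨rfl, univ, E_subset_Ebar univ_mem_E,
      (p.χ.onBar_E univ_mem_E).2 p.χ.on_univ, rfl⟩, ?_, ?_⟩
    · rintro p q ⟨h, A, hA, h1, h2⟩
      exact ⟨h.symm, A, hA, h ▸ h1, h2.symm⟩
    · rintro p q r ⟨h, A, hA, h1, h2⟩ ⟨h', B, hB, h3, h4⟩
      refine ⟨h.trans h', A ∩ B, inter_mem_Ebar hA hB,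
        p.χ.onBar_inter hA hB h1 (h ▸ h3), ?_⟩
      rw [pmul_partialId_eq] at h2 h4 ⊢
      exact fun x hx y => (h2 x hx.1 y).trans (h4 x hx.2 y)

variable (P) in
/-- The underlying set of the transformation groupoid of `P`. -/
def Germ : Type u := Quotient (germSetoid P)

/-- The germ `[s, χ]`. -/
def Germ.mk (s : HullBar P) (χ : Omega P) (h : χ.OnBar (dom s.1)) : Germ P :=
  Quotient.mk (germSetoid P) ⟨s, χ, h⟩

theorem germ_eq {s t : HullBar P} {χ : Omega P} {hs : χ.OnBar (dom s.1)} {ht : χ.OnBar (dom t.1)} :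
    Germ.mk s χ hs = Germ.mk t χ ht ↔
      ∃ A ∈ Ebar P, χ.OnBar A ∧ ∀ x ∈ A, ∀ y, y ∈ s.1 x ↔ y ∈ t.1 x := by
  refine (Quotient.eq (r := germSetoid P)).trans ?_
  change PreGerm.Rel _ _ ↔ _
  simp only [PreGerm.Rel, pmul_partialId_eq, true_and]

/-- The source `χ` of `[s, χ]`. -/
def Germ.src : Germ P → Omega P := Quotient.lift (fun p => p.χ) fun _ _ h => h.1

theorem act_congr {s t : HullBar P} {χ : Omega P} {hs : χ.OnBar (dom s.1)}
    {ht : χ.OnBar (dom t.1)} {A : Set P} (hA : A ∈ Ebar P) (h : χ.OnBar A)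
    (hst : ∀ x ∈ A, ∀ y, y ∈ s.1 x ↔ y ∈ t.1 x) : act s χ hs = act t χ ht := by
  refine omega_ext fun e he => ?_
  obtain ⟨c, hc⟩ := χ.exists_agreeBar (T := {A, pull s.1 e, pull t.1 e}) (by simp) (by
    simp only [insert_subset_iff, singleton_subset_iff]
    exact ⟨hA, pull_mem_Ebar s.2 (E_subset_Ebar he), pull_mem_Ebar t.2 (E_subset_Ebar he)⟩)
  rw [hc _ (by simp)] at h
  rw [act_on he, act_on he, hc _ (by simp), hc _ (by simp)]
  exact exists_congr fun y => and_congr_right fun _ => hst c h y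

/-- The target `s · χ` of `[s, χ]`. -/
def Germ.tgt : Germ P → Omega P :=
  Quotient.lift (fun p => act p.s p.χ p.h) (by
    rintro ⟨s, χ, hs⟩ ⟨t, ψ, ht⟩ ⟨h, A, hA, h1, h2⟩
    obtain rfl : χ = ψ := h
    exact act_congr hA h1 (pmul_partialId_eq.1 h2))

theorem onBar_dom_mul {s t : HullBar P} {χ : Omega P} (ht : χ.OnBar (dom t.1))
    (hs : (act t χ ht).OnBar (dom s.1)) : χ.OnBar (dom (s.mul t).1) := by
  rw [act_onBar (dom_mem_Ebar s.2)] at hs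
  have : dom (s.mul t).1 = pull t.1 (dom s.1) := by
    ext x
    change (∃ z, z ∈ pmul s.1 t.1 x) ↔ ∃ y, (∃ z, z ∈ s.1 y) ∧ y ∈ t.1 x
    simp only [mem_pmul]
    constructor
    · rintro ⟨z, y, h1, h2⟩; exact ⟨y, ⟨z, h2⟩, h1⟩
    · rintro ⟨y, ⟨z, h2⟩, h1⟩; exact ⟨z, y, h1, h2⟩
  rwa [this]

theorem germ_mul_congr {s s' t t' : HullBar P} {χ ψ : Omega P} {ht : χ.OnBar (dom t.1)}
    {ht' : χ.OnBar (dom t'.1)} {hs : ψ.OnBar (dom s.1)} {hs' : ψ.OnBar (dom s'.1)}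
    (h1 : ψ = act t χ ht) (h2 : ψ = act t' χ ht')
    (e1 : Germ.mk s ψ hs = Germ.mk s' ψ hs') (e2 : Germ.mk t χ ht = Germ.mk t' χ ht') :
    Germ.mk (s.mul t) χ (onBar_dom_mul ht (h1 ▸ hs)) =
      Germ.mk (s'.mul t') χ (onBar_dom_mul ht' (h2 ▸ hs')) := by
  obtain ⟨A, hA, hA1, hA2⟩ := germ_eq.1 e1
  obtain ⟨B, hB, hB1, hB2⟩ := germ_eq.1 e2
  rw [h1, act_onBar hA] at hA1
  refine germ_eq.2 ⟨pull t.1 A ∩ B, inter_mem_Ebar (pull_mem_Ebar t.2 hA) hB,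
    χ.onBar_inter (pull_mem_Ebar t.2 hA) hB hA1 hB1, ?_⟩
  rintro x ⟨⟨y, hy, hxy⟩, hx⟩ z
  change z ∈ pmul s.1 t.1 x ↔ z ∈ pmul s'.1 t'.1 x
  rw [mem_pmul, mem_pmul]
  constructor
  · rintro ⟨w, hw, hz⟩
    obtain rfl := mem_unique hw hxy
    exact ⟨w, (hB2 x hx w).1 hw, (hA2 w hy z).1 hz⟩
  · rintro ⟨w, hw, hz⟩
    obtain rfl := mem_unique ((hB2 x hx w).2 hw) hxy
    exact ⟨w, hxy, (hA2 w hy z).2 hz⟩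

theorem exists_mul (α β : Germ P) (h : α.src = β.tgt) :
    ∃ γ : Germ P, ∀ (s t : HullBar P) (χ : Omega P) (ht : χ.OnBar (dom t.1))
      (hs : (act t χ ht).OnBar (dom s.1)), α = Germ.mk s (act t χ ht) hs → β = Germ.mk t χ ht →
      γ = Germ.mk (s.mul t) χ (onBar_dom_mul ht hs) := by
  induction α using Quotient.inductionOn with | _ p
  induction β using Quotient.inductionOn with | _ q
  obtain ⟨s, ψ, hs⟩ := p
  obtain ⟨t, χ, ht⟩ := q
  obtain rfl : ψ = act t χ ht := h
  refine ⟨Germ.mk (s.mul t) χ (onBar_dom_mul ht hs), ?_⟩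
  intro s' t' χ' ht' hs' e1 e2
  obtain rfl : χ = χ' := congrArg Germ.src e2
  have h2 : act t χ ht = act t' χ ht' := congrArg Germ.tgt e2
  refine germ_mul_congr (hs := hs) (hs' := h2 ▸ hs') rfl h2 ?_ e2
  refine Eq.trans e1 ?_
  congr 1
  exact h2.symm

/-- The product of two composable elements, determined by `[s, t · χ] [t, χ] = [s t, χ]`,
see `Germ.mul_mk`. -/
def Germ.mul (α β : Germ P) (h : α.src = β.tgt) : Germ P := (exists_mul α β h).choose

theorem Germ.mul_mk {s t : HullBar P} {χ : Omega P} (ht : χ.OnBar (dom t.1))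
    (hs : (act t χ ht).OnBar (dom s.1)) :
    (Germ.mk s (act t χ ht) hs).mul (Germ.mk t χ ht) rfl =
      Germ.mk (s.mul t) χ (onBar_dom_mul ht hs) :=
  (exists_mul (Germ.mk s (act t χ ht) hs) (Germ.mk t χ ht) rfl).choose_spec s t χ ht hs rfl rfl

/-- The unit `[1, χ]` at `χ`. -/
def Germ.unit (χ : Omega P) : Germ P :=
  Germ.mk (HullBar.of 1) χ (by
    have : dom (HullBar.of (1 : P)).1 = univ := by
      ext x
      change (∃ y, y ∈ leftMul 1 x) ↔ _
      simp only [mem_leftMul, exists_eq, mem_univ]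
    rw [this, χ.onBar_E univ_mem_E]
    exact χ.on_univ)

theorem onBar_dom_inv {s : HullBar P} {χ : Omega P} (hs : χ.OnBar (dom s.1)) :
    (act s χ hs).OnBar (dom s.inv.1) := by
  rw [act_onBar (dom_mem_Ebar s.inv.2)]
  have : pull s.1 (dom s.inv.1) = dom s.1 := by
    ext x
    constructor
    · rintro ⟨y, -, h⟩; exact ⟨y, h⟩
    · rintro ⟨y, h⟩; exact ⟨y, ⟨x, (PEquiv.mem_iff_mem s.1).2 h⟩, h⟩
  rwa [this]

theorem germ_inv_congr {s t : HullBar P} {χ : Omega P} {hs : χ.OnBar (dom s.1)}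
    {ht : χ.OnBar (dom t.1)} (e : Germ.mk s χ hs = Germ.mk t χ ht) :
    Germ.mk s.inv (act s χ hs) (onBar_dom_inv hs) =
      Germ.mk t.inv (act t χ ht) (onBar_dom_inv ht) := by
  have htgt : act s χ hs = act t χ ht := congrArg Germ.tgt e
  obtain ⟨A, hA, hA1, hA2⟩ := germ_eq.1 e
  have hB : pull s.inv.1 A ∈ Ebar P := pull_mem_Ebar s.inv.2 hA
  have hB' : pull t.inv.1 A ∈ Ebar P := pull_mem_Ebar t.inv.2 hA
  have aux : ∀ (r : HullBar P) (hr : χ.OnBar (dom r.1)),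
      (act r χ hr).OnBar (pull r.inv.1 A) := by
    intro r hr
    have hC := pull_mem_Ebar r.inv.2 hA
    rw [act_onBar hC]
    have : pull r.1 (pull r.inv.1 A) = A ∩ dom r.1 := by
      ext x
      constructor
      · rintro ⟨y, ⟨z, hz, hyz⟩, h⟩
        obtain rfl := r.1.inj ((PEquiv.mem_iff_mem r.1).1 hyz) h
        exact ⟨hz, y, h⟩
      · rintro ⟨hx, y, h⟩
        exact ⟨y, ⟨x, hx, (PEquiv.mem_iff_mem r.1).2 h⟩, h⟩
    rw [this]
    exact χ.onBar_inter hA (dom_mem_Ebar r.2) hA1 hr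
  have h1 := aux s hs
  have h2 := aux t ht
  rw [← htgt] at h2
  have : Germ.mk t.inv (act t χ ht) (onBar_dom_inv ht) =
      Germ.mk t.inv (act s χ hs) (htgt ▸ onBar_dom_inv ht) := by
    congr 1
    exact htgt.symm
  rw [this]
  refine germ_eq.2 ⟨pull s.inv.1 A ∩ pull t.inv.1 A, inter_mem_Ebar hB hB',
    Omega.onBar_inter _ hB hB' h1 h2, ?_⟩
  rintro y ⟨⟨x, hx, hyx⟩, x', hx', hyx'⟩ z
  have k1 := (PEquiv.mem_iff_mem s.1).1 hyx
  have k2 := (hA2 x hx y).1 k1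
  change z ∈ s.1.symm y ↔ z ∈ t.1.symm y
  have hyx2 := (PEquiv.mem_iff_mem t.1).2 k2
  constructor
  · intro hz
    obtain rfl : z = x := mem_unique hz hyx
    exact hyx2
  · intro hz
    obtain rfl : z = x := mem_unique hz hyx2
    exact hyx

/-- The inverse `[s⁻¹, s · χ]` of `[s, χ]`. -/
def Germ.inv : Germ P → Germ P :=
  Quotient.lift (fun p => Germ.mk p.s.inv (act p.s p.χ p.h) (onBar_dom_inv p.h)) (by
    rintro ⟨s, χ, hs⟩ ⟨t, ψ, ht⟩ h
    obtain rfl : χ = ψ := h.1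
    exact germ_inv_congr (Quotient.sound (s := germSetoid P) h))

theorem Germ.src_inv (γ : Germ P) : γ.inv.src = γ.tgt := by
  induction γ using Quotient.inductionOn with | _ p
  rfl

theorem Germ.tgt_inv (γ : Germ P) : γ.inv.tgt = γ.src := by
  induction γ using Quotient.inductionOn with | _ p
  obtain ⟨s, χ, hs⟩ := p
  change act s.inv (act s χ hs) (onBar_dom_inv hs) = χ
  refine omega_ext fun e he => ?_
  have hC := pull_mem_Ebar s.inv.2 (E_subset_Ebar he)
  rw [act_on he, act_onBar hC, ← χ.onBar_E he]
  have hD := pull_mem_Ebar s.2 hC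
  obtain ⟨c, hc⟩ := χ.exists_agreeBar (T := {dom s.1, e, pull s.1 (pull s.inv.1 e)}) (by simp) (by
    simp only [insert_subset_iff, singleton_subset_iff]
    exact ⟨dom_mem_Ebar s.2, E_subset_Ebar he, hD⟩)
  rw [hc _ (by simp)] at hs
  obtain ⟨y, hy⟩ := hs
  rw [hc _ (by simp), hc _ (by simp)]
  constructor
  · rintro ⟨z, ⟨w, hw, hzw⟩, h⟩
    obtain rfl := s.1.inj ((PEquiv.mem_iff_mem s.1).1 hzw) h
    exact hw
  · intro h
    exact ⟨y, ⟨c, h, (PEquiv.mem_iff_mem s.1).2 hy⟩, hy⟩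

/-- The topology generated by the sets `[s, U]`, for `U` an open subset of the domain of `s`. -/
instance : TopologicalSpace (Germ P) :=
  TopologicalSpace.generateFrom
    {B | ∃ (s : HullBar P) (U : Set (Omega P)) (hU : ∀ χ ∈ U, χ.OnBar (dom s.1)), IsOpen U ∧
      B = {γ | ∃ (χ : Omega P) (hχ : χ ∈ U), γ = Germ.mk s χ (hU χ hχ)}}

variable (P) in
/-- The isotropy of the groupoid. -/
def Iso : Set (Germ P) := {γ | γ.src = γ.tgt}

variable (P) in
/-- The unit space of the groupoid, as a set of arrows. -/
def unitSpace : Set (Germ P) := range Germ.unit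

variable (P) in
/-- The subgroupoid `P^* ⋉ Ω`: the germs of the invertible elements of `P`. -/
def unitsAction : Set (Germ P) :=
  {γ | ∃ (c : P) (χ : Omega P) (h : χ.OnBar (dom (HullBar.of c).1)),
    IsUnit c ∧ γ = Germ.mk (HullBar.of c) χ h}

/-! ### Reduced C*-algebras and ideal detection -/

variable (P) in
/-- The Hilbert space `ℓ²` of the groupoid, i.e. the direct sum over all units `x` of the spaces
`ℓ²(G_x)` of the regular representations. -/
abbrev L2 : Type u := lp (fun _ : Germ P => ℂ) 2

open Classical in
/-- `T` is the operator of left convolution by `f`, i.e. the direct sum of the images of `f` in the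
regular representations: the matrix entry of `T` at `(γ, β)` is `f (γ β⁻¹)` if `γ` and `β` have
the same source, and `0` otherwise. -/
def IsConvolution (f : Germ P → ℂ) (T : L2 P →L[ℂ] L2 P) : Prop :=
  ∀ γ β : Germ P, (T (lp.single 2 β (1 : ℂ)) : L2 P) γ =
    if h : γ.src = β.src then f (γ.mul β.inv (h.trans β.tgt_inv.symm)) else 0

/-- The reduced C*-algebra of an open subgroupoid `H`, as a subalgebra of the bounded operators on
`ℓ²`: the C*-algebra generated by the convolution operators of the continuous functions whose
support is compact and contained in `H`. -/
def reducedCStar (H : Set (Germ P)) : NonUnitalStarSubalgebra ℂ (L2 P →L[ℂ] L2 P) :=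
  (NonUnitalStarAlgebra.adjoin ℂ {T | ∃ f : Germ P → ℂ,
    Continuous f ∧ HasCompactSupport f ∧ tsupport f ⊆ H ∧ IsConvolution f T}).topologicalClosure

/-- The C*-subalgebra `B` of `A` detects ideals in `A`: the only closed two-sided ideal `J` of `A`
with `B ∩ J = 0` is the zero ideal. -/
def DetectsIdeals {R : Type u} [NonUnitalRing R] [StarRing R] [Module ℂ R] [TopologicalSpace R]
    (A B : NonUnitalStarSubalgebra ℂ R) : Prop :=
  B ≤ A ∧ ∀ J : TwoSidedIdeal A, IsClosed {x : A | x ∈ J} →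
    (∀ x : A, x ∈ J → (x : R) ∈ B → x = 0) → J = ⊥

end LeftCancellative

/-! ### The monoid `ℤ ⋊ ℕ^×` -/

/-- The semidirect product `ℤ ⋊ ℕ^×`, where `ℕ^×` is the multiplicative monoid of positive
integers. -/
@[ext]
structure ZNat where
  k : ℤ
  a : ℕ+

namespace ZNat

/-- The product `(k, a)(l, b) = (k + a l, a b)`. -/
instance : Monoid ZNat where
  mul x y := ⟨x.k + (x.a : ℤ) * y.k, x.a * y.a⟩
  one := ⟨0, 1⟩
  mul_assoc x y z := by
    apply ZNat.ext
    · change (x.k + (x.a : ℤ) * y.k) + ((x.a * y.a : ℕ+) : ℤ) * z.k =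
        x.k + (x.a : ℤ) * (y.k + (y.a : ℤ) * z.k)
      push_cast
      ring
    · exact mul_assoc x.a y.a z.a
  one_mul x := by
    apply ZNat.ext
    · change (0 : ℤ) + ((1 : ℕ+) : ℤ) * x.k = x.k
      simp
    · exact one_mul x.a
  mul_one x := by
    apply ZNat.ext
    · change x.k + (x.a : ℤ) * 0 = x.k
      simp
    · exact mul_one x.a

instance : IsLeftCancelMul ZNat where
  mul_left_cancel x y z h := by
    have h1 : x.k + (x.a : ℤ) * y.k = x.k + (x.a : ℤ) * z.k := congrArg ZNat.k h
    have h2 : x.a * y.a = x.a * z.a := congrArg ZNat.a h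
    apply ZNat.ext
    · have hx : (x.a : ℤ) ≠ 0 := by exact_mod_cast x.a.ne_zero
      exact mul_left_cancel₀ hx (by linarith)
    · exact mul_left_cancel h2

end ZNat

end

/-! Everything rests on two properties of ℤ ⋊ ℕ^×.

Rigidity: every element of the hull is a restriction of a map (k, a) ↦ (r k + t, r a), with r a
positive rational (`affine_of_inHull`). One value determines such a map. Hence an element with a
fixed point is idempotent (`eq_of_fixed`), and elements that agree at one point agree on their
common domain, so the groupoid is Hausdorff.

Displacement: suppose s moves p to p' ≠ p. For q = (k, b) with suitable k and b a large prime, the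
right ideals p q P and p' q P are disjoint, since the first coordinates of their elements lie in
different classes modulo b. As s commutes with right multiplication, it carries p q P, where
defined, into p' q P. Moreover p q stays in any given A ∈ `Ebar` that contains p, because no fixed
finite set of constraints sees a large prime factor. So every A ∈ `Ebar` containing p has a nonempty
subset in `Ebar` that s moves off itself (`exists_moved_off`). Evaluation at a point of this subset
is a character not fixed by s, so an open set of isotropy germs consists of units. The translation
by (1, 1) has no fixed point, which makes the inclusion into P^* ⋉ Ω strict.

For ideals, the regular representation on ℓ² of the groupoid is used, where each hull element acts
as a partial isometry with 0-1 matrix. The reduced C*-algebras lie in the closed span of these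
operators. On that span, diagonal entries depend continuously on the target
(`exists_diagonal_close`), and every operator becomes almost scalar after compression to a small
corner 1_B (`exists_compress_close`). If x ≠ 0 lies in a closed ideal, then x* x has a positive
diagonal entry, so some compression of x* x is close to a nonzero multiple of 1_B. A geometric
series puts 1_B in the ideal, and 1_B lies in the algebra of the unit space. That algebra is
diagonal, while the translation operator is not, so the last inclusion is strict. -/

namespace LeftCancellative

universe u

/-! ### Weighted partial shifts on `ℓ²` -/

section Shift

variable {ι : Type u}

/-- The coordinates of the image of `ξ` under the partial shift along `φ`. -/
def shiftFun (φ : ι ≃. ι) (ξ : ι → ℂ) (i : ι) : ℂ := (φ.symm i).elim 0 ξ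

theorem shiftFun_of_mem {φ : ι ≃. ι} {ξ : ι → ℂ} {i j : ι} (h : i ∈ φ j) :
    shiftFun φ ξ i = ξ j := by
  have : φ.symm i = some j := (PEquiv.mem_iff_mem φ).2 h
  simp [shiftFun, this]

theorem shiftFun_of_not_mem {φ : ι ≃. ι} {ξ : ι → ℂ} {i : ι} (h : ∀ j, i ∉ φ j) :
    shiftFun φ ξ i = 0 := by
  have : φ.symm i = none := by
    rw [Option.eq_none_iff_forall_not_mem]
    exact fun j hj => h j ((PEquiv.mem_iff_mem φ).1 hj)
  simp [shiftFun, this]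

-- Every nonzero coordinate of the image is a coordinate of `ξ`, and no coordinate of `ξ` is used
-- twice because a partial bijection has at most one value at each point.
open Classical in
theorem sum_shiftFun_le (φ : ι ≃. ι) (ξ : lp (fun _ : ι => ℂ) 2) (s : Finset ι) :
    ∑ i ∈ s, ‖shiftFun φ ξ i‖ ^ (2 : ENNReal).toReal ≤ ‖ξ‖ ^ (2 : ENNReal).toReal := by
  have h2 : (0 : ℝ) < (2 : ENNReal).toReal := by norm_num
  have hs : ∑ i ∈ s, ‖shiftFun φ ξ i‖ ^ (2 : ENNReal).toReal =
      ∑ i ∈ s.filter (fun i => ∃ j, i ∈ φ j), ‖shiftFun φ ξ i‖ ^ (2 : ENNReal).toReal := by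
    refine (Finset.sum_filter_of_ne fun i _ hi => ?_).symm
    by_contra h
    push Not at h
    rw [shiftFun_of_not_mem h, norm_zero, Real.zero_rpow h2.ne'] at hi
    exact hi rfl
  -- On the filtered set `φ.symm i` is defined, so the default value of `getD` never occurs.
  have key : ∀ i ∈ s.filter (fun i => ∃ j, i ∈ φ j), i ∈ φ ((φ.symm i).getD i) := by
    intro i hi
    obtain ⟨j, hj⟩ := (Finset.mem_filter.1 hi).2
    have : φ.symm i = some j := (PEquiv.mem_iff_mem φ).2 hj
    rw [this]
    exact hj
  rw [hs, Finset.sum_congr rfl fun i hi => by rw [shiftFun_of_mem (key i hi)],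
    ← Finset.sum_image (f := fun j => ‖ξ j‖ ^ (2 : ENNReal).toReal) (g := fun i => (φ.symm i).getD i)]
  · exact lp.sum_rpow_le_norm_rpow h2 ξ _
  · intro i hi j hj hij
    have hi := key i hi
    have hj := key j hj
    change (φ.symm i).getD i = (φ.symm j).getD j at hij
    rw [hij] at hi
    exact mem_unique hi hj

/-- The partial isometry of `ℓ²` that moves the coordinates along a partial bijection. -/
noncomputable def shift (φ : ι ≃. ι) : lp (fun _ : ι => ℂ) 2 →L[ℂ] lp (fun _ : ι => ℂ) 2 :=
  LinearMap.mkContinuous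
    { toFun := fun ξ => ⟨shiftFun φ ξ, memℓp_gen' (sum_shiftFun_le φ ξ)⟩
      map_add' := fun ξ η => by
        ext i
        change shiftFun φ (ξ + η : lp (fun _ : ι => ℂ) 2) i = shiftFun φ ξ i + shiftFun φ η i
        unfold shiftFun
        cases φ.symm i with
        | none => exact (add_zero 0).symm
        | some j => rfl
      map_smul' := fun c ξ => by
        ext i
        change shiftFun φ (c • ξ : lp (fun _ : ι => ℂ) 2) i = c • shiftFun φ ξ i
        unfold shiftFun
        cases φ.symm i with
        | none => exact (mul_zero c).symm
        | some j => rfl }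
    1 fun ξ => by
      rw [one_mul]
      exact lp.norm_le_of_forall_sum_le (by norm_num) (norm_nonneg _) (sum_shiftFun_le φ ξ)

theorem shift_apply (φ : ι ≃. ι) (ξ : lp (fun _ : ι => ℂ) 2) (i : ι) :
    shift φ ξ i = shiftFun φ ξ i := rfl

theorem norm_shift_le (φ : ι ≃. ι) : ‖shift φ‖ ≤ 1 := LinearMap.mkContinuous_norm_le _ zero_le_one _

theorem shift_mul (φ ψ : ι ≃. ι) : shift φ * shift ψ = shift (pmul φ ψ) := by
  ext ξ i
  rw [mul_apply_eq_comp, shift_apply, shift_apply]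
  by_cases h : ∃ j, i ∈ φ j
  · obtain ⟨j, hj⟩ := h
    rw [shiftFun_of_mem hj, shift_apply]
    by_cases h' : ∃ k, j ∈ ψ k
    · obtain ⟨k, hk⟩ := h'
      rw [shiftFun_of_mem hk, shiftFun_of_mem (mem_pmul.2 ⟨j, hk, hj⟩)]
    · push Not at h'
      rw [shiftFun_of_not_mem h', shiftFun_of_not_mem]
      intro k hk
      obtain ⟨l, hl, hl'⟩ := mem_pmul.1 hk
      exact h' k (φ.inj hj hl' ▸ hl)
  · push Not at h
    rw [shiftFun_of_not_mem h, shiftFun_of_not_mem]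
    intro k hk
    obtain ⟨l, _, hl'⟩ := mem_pmul.1 hk
    exact h l hl'

open Classical in
theorem shift_single (φ : ι ≃. ι) (i j : ι) :
    (shift φ (lp.single 2 j (1 : ℂ)) : lp (fun _ : ι => ℂ) 2) i = if i ∈ φ j then 1 else 0 := by
  rw [shift_apply]
  by_cases h : ∃ k, i ∈ φ k
  · obtain ⟨k, hk⟩ := h
    rw [shiftFun_of_mem hk, lp.single_apply]
    by_cases hkj : k = j
    · subst hkj; simp [hk]
    · rw [Pi.single_eq_of_ne hkj, if_neg fun h => hkj (φ.inj hk h)]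
  · push Not at h
    rw [shiftFun_of_not_mem h, if_neg (h j)]

open Classical in
/-- Bounded operators on `ℓ²` are determined by their matrix entries. -/
theorem clm_ext_single {S T : lp (fun _ : ι => ℂ) 2 →L[ℂ] lp (fun _ : ι => ℂ) 2}
    (h : ∀ i j, (S (lp.single 2 j (1 : ℂ)) : lp (fun _ : ι => ℂ) 2) i =
      (T (lp.single 2 j (1 : ℂ)) : lp (fun _ : ι => ℂ) 2) i) : S = T := by
  have h1 : ∀ j, S (lp.single 2 j (1 : ℂ)) = T (lp.single 2 j (1 : ℂ)) :=
    fun j => lp.ext (funext fun i => h i j)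
  refine ContinuousLinearMap.ext fun ξ => ?_
  have hξ := lp.hasSum_single (p := 2) (by norm_num) ξ
  have key : ∀ j, S (lp.single 2 j (ξ j)) = T (lp.single 2 j (ξ j)) := by
    intro j
    have : (lp.single 2 j (ξ j) : lp (fun _ : ι => ℂ) 2) = ξ j • lp.single 2 j (1 : ℂ) := by
      rw [← lp.single_smul, smul_eq_mul, mul_one]
    rw [this, map_smul, map_smul, h1]
  have hS := hξ.mapL S
  have hT := hξ.mapL T
  simp only [key] at hS
  exact hS.unique hT

open Classical in
theorem star_matrix (T : lp (fun _ : ι => ℂ) 2 →L[ℂ] lp (fun _ : ι => ℂ) 2) (i j : ι) :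
    (star T (lp.single 2 j (1 : ℂ)) : lp (fun _ : ι => ℂ) 2) i =
      star ((T (lp.single 2 i (1 : ℂ)) : lp (fun _ : ι => ℂ) 2) j) := by
  have h := ContinuousLinearMap.adjoint_inner_right T (lp.single 2 i (1 : ℂ)) (lp.single 2 j (1 : ℂ))
  rw [lp.inner_single_left, lp.inner_single_right] at h
  simpa [ContinuousLinearMap.star_eq_adjoint] using h

theorem star_shift (φ : ι ≃. ι) : star (shift φ) = shift φ.symm := by
  classical
  refine clm_ext_single fun i j => ?_
  rw [star_matrix, shift_single, shift_single]
  simp only [PEquiv.mem_iff_mem]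
  split_ifs <;> simp

open Classical in
theorem norm_matrix_le (T : lp (fun _ : ι => ℂ) 2 →L[ℂ] lp (fun _ : ι => ℂ) 2) (i j : ι) :
    ‖(T (lp.single 2 j (1 : ℂ)) : lp (fun _ : ι => ℂ) 2) i‖ ≤ ‖T‖ := by
  refine (lp.norm_apply_le_norm (by norm_num) _ i).trans ((T.le_opNorm _).trans ?_)
  rw [lp.norm_single (by norm_num)]
  simp

theorem exists_mulOp {C : ℝ} (hC : 0 ≤ C) (a : ι → ℂ) (ha : ∀ i, ‖a i‖ ≤ C) :
    ∃ T : lp (fun _ : ι => ℂ) 2 →L[ℂ] lp (fun _ : ι => ℂ) 2,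
      ‖T‖ ≤ C ∧ ∀ ξ i, (T ξ : lp (fun _ : ι => ℂ) 2) i = a i * ξ i := by
  have key : ∀ (ξ : lp (fun _ : ι => ℂ) 2) (s : Finset ι),
      ∑ i ∈ s, ‖a i * ξ i‖ ^ (2 : ENNReal).toReal ≤ (C * ‖ξ‖) ^ (2 : ENNReal).toReal := by
    intro ξ s
    rw [Real.mul_rpow hC (norm_nonneg _)]
    refine le_trans ?_ (mul_le_mul_of_nonneg_left
      (lp.sum_rpow_le_norm_rpow (by norm_num) ξ s) (by positivity))
    rw [Finset.mul_sum]
    refine Finset.sum_le_sum fun i _ => ?_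
    rw [norm_mul, Real.mul_rpow (norm_nonneg _) (norm_nonneg _)]
    have := ha i
    gcongr
  refine ⟨LinearMap.mkContinuous
    { toFun := fun ξ => ⟨fun i => a i * ξ i, memℓp_gen' (key ξ)⟩
      map_add' := fun ξ η => by
        ext i
        exact mul_add (a i) (ξ i) (η i)
      map_smul' := fun c ξ => by
        ext i
        exact mul_left_comm (a i) c (ξ i) } C fun ξ =>
      lp.norm_le_of_forall_sum_le (by norm_num) (by positivity) (key ξ),
    LinearMap.mkContinuous_norm_le _ hC _, fun ξ i => rfl⟩

end Shift

variable {P : Type u} [Monoid P] [IsLeftCancelMul P]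

/-! ### The topology of the space of characters -/

/-- Boolean rules for the extended character are checked at a single point of `P`: on finitely many
sets `χ` agrees with evaluation at some `c`. -/
theorem onBar_union (χ : Omega P) {A B : Set P} (hA : A ∈ Ebar P) (hB : B ∈ Ebar P) :
    A ∪ B ∈ Ebar P ∧ (χ.OnBar (A ∪ B) ↔ χ.OnBar A ∨ χ.OnBar B) := by
  have hAB : A ∪ B ∈ Ebar P := by
    obtain ⟨S, hS, rfl⟩ := hA
    obtain ⟨T, hT, rfl⟩ := hB
    refine ⟨S ∪ T, ⟨hS.1.union hT.1, ?_⟩, ?_⟩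
    · rintro p (hp | hp)
      · exact hS.2 p hp
      · exact hT.2 p hp
    · simp only [repSet, biUnion_union]
  refine ⟨hAB, ?_⟩
  obtain ⟨c, hc⟩ := χ.exists_agreeBar (T := {A, B, A ∪ B}) (by simp) (by
    simp only [insert_subset_iff, singleton_subset_iff]
    exact ⟨hA, hB, hAB⟩)
  rw [hc _ (by simp), hc _ (by simp), hc _ (by simp), mem_union]

theorem onBar_mono {χ : Omega P} {A B : Set P} (hA : A ∈ Ebar P) (hB : B ∈ Ebar P) (h : A ⊆ B)
    (hχ : χ.OnBar A) : χ.OnBar B := by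
  obtain ⟨c, hc⟩ := χ.exists_agreeBar (T := {A, B}) (by simp) (by
    simp only [insert_subset_iff, singleton_subset_iff]
    exact ⟨hA, hB⟩)
  rw [hc _ (by simp)] at hχ ⊢
  exact h hχ

theorem onBar_nonempty {χ : Omega P} {A : Set P} (hA : A ∈ Ebar P) (hχ : χ.OnBar A) :
    A.Nonempty := by
  obtain ⟨c, hc⟩ := χ.exists_agreeBar (T := {A}) (by simp) (by simpa using hA)
  exact ⟨c, (hc _ (by simp)).1 hχ⟩

theorem onBar_univ (χ : Omega P) : χ.OnBar univ := (χ.onBar_E univ_mem_E).2 χ.on_univ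

theorem compl_mem_Ebar {A : Set P} (hA : A ∈ E P) : Aᶜ ∈ Ebar P := by
  refine ⟨{(univ, {A})}, ⟨finite_singleton _, ?_⟩, ?_⟩
  · rintro p rfl
    refine ⟨univ_mem_E, finite_singleton _, ?_⟩
    rintro f rfl
    exact ⟨hA, subset_univ _⟩
  · simp [repSet, compl_eq_univ_sdiff]

theorem onBar_compl (χ : Omega P) {A : Set P} (hA : A ∈ E P) : χ.OnBar Aᶜ ↔ ¬ χ.On A := by
  obtain ⟨c, hc⟩ := χ.exists_agreeBar (T := {A, Aᶜ}) (by simp) (by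
    simp only [insert_subset_iff, singleton_subset_iff]
    exact ⟨E_subset_Ebar hA, compl_mem_Ebar hA⟩)
  rw [← χ.onBar_E hA, hc _ (by simp), hc _ (by simp), mem_compl_iff]

/-- The set of characters that take the value `1` at `A`. -/
def cyl (A : Set P) : Set (Omega P) := {χ | χ.OnBar A}

theorem isClopen_on {A : Set P} (hA : A ∈ E P) : IsClopen {χ : Omega P | χ.On A} := by
  have : {χ : Omega P | χ.On A} = (fun χ : Omega P => χ.1 ⟨A, hA⟩) ⁻¹' {true} := by
    ext χ
    simp [Omega.On, hA]
  rw [this]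
  have hc : Continuous fun χ : Omega P => χ.1 ⟨A, hA⟩ :=
    (continuous_apply (⟨A, hA⟩ : E P)).comp (continuous_subtype_val (p := IsOmega))
  exact (isClopen_discrete _).preimage hc

theorem isClopen_cyl {A : Set P} (hA : A ∈ Ebar P) : IsClopen (cyl A) := by
  obtain ⟨S, hS, rfl⟩ := hA
  have : cyl (repSet S) =
      ⋃ p ∈ S, ({χ : Omega P | χ.On p.1} ∩ ⋂ f ∈ p.2, {χ : Omega P | χ.On f}ᶜ) := by
    ext χ
    simp only [cyl, mem_ofPred_eq, χ.onBar_iff hS, mem_iUnion, mem_inter_iff, mem_iInter,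
      mem_compl_iff, exists_prop]
  rw [this]
  refine hS.1.isClopen_biUnion fun p hp => ?_
  obtain ⟨h1, h2, h3⟩ := hS.2 p hp
  exact (isClopen_on h1).inter (h2.isClopen_biInter fun f hf => (isClopen_on (h3 f hf).1).compl)

instance : T2Space (Omega P) := inferInstanceAs (T2Space {χ : E P → Bool // IsOmega χ})

instance : TotallyDisconnectedSpace (Omega P) :=
  inferInstanceAs (TotallyDisconnectedSpace {χ : E P → Bool // IsOmega χ})

instance : CompactSpace (Omega P) := by
  have h : IsClosed {χ : E P → Bool | IsOmega χ} := by
    -- Being nonzero is not visibly a closed condition. For a semicharacter it amounts to `χ univ =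
    -- true`, which is closed.
    have : {χ : E P → Bool | IsOmega χ} =
        {χ | χ ⟨univ, univ_mem_E⟩ = true} ∩
        (⋂ (e : E P) (f : E P) (g : E P) (_ : g.1 = e.1 ∩ f.1), {χ | χ g = (χ e && χ f)}) ∩
        ⋂ (f : E P) (S : Finset (E P)) (_ : f.1 = ⋃ e ∈ S, e.1),
          {χ | χ f = true ↔ ∃ e ∈ S, χ e = true} := by
      ext χ
      simp only [mem_ofPred_eq, mem_inter_iff, mem_iInter]
      constructor
      · intro h
        obtain ⟨_, h1⟩ := Omega.on_univ ⟨χ, h⟩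
        exact ⟨⟨h1, h.map_inf⟩, h.map_sup⟩
      · rintro ⟨⟨h1, h2⟩, h3⟩
        exact ⟨⟨_, h1⟩, h2, h3⟩
    rw [this]
    have hc : ∀ e : E P, IsClopen {χ : E P → Bool | χ e = true} := fun e =>
      (isClopen_discrete {true}).preimage (continuous_apply e)
    refine ((hc _).isClosed.inter ?_).inter ?_
    · refine isClosed_iInter fun e => isClosed_iInter fun f => isClosed_iInter fun g =>
        isClosed_iInter fun _ => ?_
      have hand : Continuous fun p : Bool × Bool => (p.1 && p.2) := continuous_of_discreteTopology
      have hef : Continuous fun χ : E P → Bool => (χ e, χ f) :=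
        (continuous_apply e).prodMk (continuous_apply f)
      exact isClosed_eq (continuous_apply g) (hand.comp hef)
    · refine isClosed_iInter fun f => isClosed_iInter fun S => isClosed_iInter fun _ => ?_
      have h2 : IsClopen {χ : E P → Bool | ∃ e ∈ S, χ e = true} := by
        have : {χ : E P → Bool | ∃ e ∈ S, χ e = true} = ⋃ e ∈ S, {χ | χ e = true} := by
          ext χ; simp
        rw [this]
        exact S.finite_toSet.isClopen_biUnion fun e _ => hc e
      have : {χ : E P → Bool | χ f = true ↔ ∃ e ∈ S, χ e = true} =
          ({χ | χ f = true} ∩ {χ | ∃ e ∈ S, χ e = true}) ∪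
          ({χ | χ f = true}ᶜ ∩ {χ | ∃ e ∈ S, χ e = true}ᶜ) := by
        ext χ
        simp only [mem_ofPred_eq, mem_union, mem_inter_iff, mem_compl_iff]
        exact iff_iff_and_or_not_and_not
      rw [this]
      exact (((hc f).inter h2).union ((hc f).compl.inter h2.compl)).isClosed
  exact isCompact_iff_compactSpace.1 h.isCompact

theorem exists_cyl_agree (χ : Omega P) (I : Finset (E P)) :
    ∃ A ∈ Ebar P, χ.OnBar A ∧ ∀ ψ : Omega P, ψ.OnBar A → ∀ e ∈ I, ψ.1 e = χ.1 e := by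
  classical
  induction I using Finset.induction_on with
  | empty => exact ⟨univ, E_subset_Ebar univ_mem_E, onBar_univ χ, by simp⟩
  | insert e I _ ih =>
    obtain ⟨A, hA, hχ, h⟩ := ih
    have : ∃ B ∈ Ebar P, χ.OnBar B ∧ ∀ ψ : Omega P, ψ.OnBar B → ψ.1 e = χ.1 e := by
      by_cases he : χ.1 e = true
      · refine ⟨e.1, E_subset_Ebar e.2, (χ.onBar_E e.2).2 ⟨e.2, he⟩, fun ψ hψ => ?_⟩
        obtain ⟨_, h⟩ := (ψ.onBar_E e.2).1 hψ
        rw [he]; exact h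
      · have aux : ∀ ψ : Omega P, ψ.On e.1 ↔ ψ.1 e = true := fun ψ =>
          ⟨fun ⟨_, h⟩ => h, fun h => ⟨e.2, h⟩⟩
        refine ⟨e.1ᶜ, compl_mem_Ebar e.2, (onBar_compl χ e.2).2 (by rwa [aux]), fun ψ hψ => ?_⟩
        have := (onBar_compl ψ e.2).1 hψ
        rw [aux] at this
        rw [Bool.not_eq_true] at this he
        rw [this, he]
    obtain ⟨B, hB, hχB, h'⟩ := this
    refine ⟨A ∩ B, inter_mem_Ebar hA hB, χ.onBar_inter hA hB hχ hχB, fun ψ hψ e' he' => ?_⟩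
    rcases Finset.mem_insert.1 he' with rfl | he'
    · exact h' ψ (onBar_mono (inter_mem_Ebar hA hB) hB inter_subset_right hψ)
    · exact h ψ (onBar_mono (inter_mem_Ebar hA hB) hA inter_subset_left hψ) e' he'

theorem exists_cyl_subset {U : Set (Omega P)} (hU : IsOpen U) {χ : Omega P} (hχ : χ ∈ U) :
    ∃ A ∈ Ebar P, χ.OnBar A ∧ cyl A ⊆ U := by
  obtain ⟨V, hV, rfl⟩ := isOpen_induced_iff.1 hU
  obtain ⟨I, u, h1, h2⟩ := isOpen_pi_iff.1 hV χ.1 hχ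
  obtain ⟨A, hA, hA1, hA2⟩ := exists_cyl_agree χ I
  refine ⟨A, hA, hA1, fun ψ hψ => h2 fun e he => ?_⟩
  rw [hA2 ψ hψ e he]
  exact (h1 e he).2

/-- A clopen set is compact, hence a finite union of the cylinders inside it, and `Ebar` is stable
under finite unions. -/
theorem exists_eq_cyl {V : Set (Omega P)} (hV : IsClopen V) : ∃ A ∈ Ebar P, V = cyl A := by
  choose! A hA hA1 hA2 using fun χ (hχ : χ ∈ V) => exists_cyl_subset hV.isOpen hχ
  obtain ⟨t, ht⟩ := hV.isClosed.isCompact.elim_nhds_subcover' (fun χ _ => cyl (A χ))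
    fun χ hχ => (isClopen_cyl (hA χ hχ)).isOpen.mem_nhds (hA1 χ hχ)
  have key : ∀ s : Finset V, ∃ B ∈ Ebar P, cyl B = ⋃ χ ∈ s, cyl (A χ.1) := by
    classical
    intro s
    induction s using Finset.induction_on with
    | empty =>
      refine ⟨∅, ⟨∅, ⟨finite_empty, by simp⟩, by simp [repSet]⟩, ?_⟩
      ext χ
      simp only [Finset.notMem_empty, iUnion_of_empty, iUnion_empty, mem_empty_iff_false,
        iff_false]
      rintro ⟨S, hS, h1, p, hp, hp1, hp2⟩
      obtain ⟨c, hc⟩ := onBar_nonempty ⟨S, hS, h1⟩ (⟨S, hS, h1, p, hp, hp1, hp2⟩ : χ.OnBar ∅)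
      exact hc
    | insert χ s _ ih =>
      obtain ⟨B, hB, h⟩ := ih
      refine ⟨A χ.1 ∪ B, (onBar_union χ.1 (hA χ.1 χ.2) hB).1, ?_⟩
      rw [Finset.set_biUnion_insert, ← h]
      ext ψ
      exact (onBar_union ψ (hA χ.1 χ.2) hB).2
  obtain ⟨B, hB, h⟩ := key t
  refine ⟨B, hB, ?_⟩
  rw [h]
  refine Subset.antisymm ?_ (iUnion₂_subset fun χ _ => hA2 χ.1 χ.2)
  intro χ hχ
  exact ht hχ

open Classical in
theorem isOmega_evalAt (p : P) : IsOmega fun e : E P => decide (p ∈ e.1) where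
  nonzero := ⟨⟨univ, univ_mem_E⟩, by simp⟩
  map_inf e f g h := by simp [h]
  map_sup f S h := by simp [h]

open Classical in
/-- Evaluation at a point of `P`. -/
noncomputable def evalAt (p : P) : Omega P := ⟨fun e => decide (p ∈ e.1), isOmega_evalAt p⟩

/-- This supplies a character on every nonempty member of `Ebar`; together with `exists_cyl_subset`,
it shows that evaluations are dense in Ω. -/
theorem evalAt_onBar {p : P} {A : Set P} (hA : A ∈ Ebar P) : (evalAt p).OnBar A ↔ p ∈ A := by
  obtain ⟨S, hS, rfl⟩ := hA
  rw [Omega.onBar_iff _ hS]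
  exact rep_agree fun e he => by simp [Omega.On, evalAt, hS.supp.2 he]

/-! ### Open bisections -/

/-- The germs of `s` at the points of `U`. -/
def bis (s : HullBar P) (U : Set (Omega P)) : Set (Germ P) :=
  {γ | ∃ (χ : Omega P) (h : χ.OnBar (dom s.1)), χ ∈ U ∧ γ = Germ.mk s χ h}

theorem isOpen_bis (s : HullBar P) {U : Set (Omega P)} (hU : IsOpen U) : IsOpen (bis s U) := by
  refine TopologicalSpace.isOpen_generateFrom_of_mem
    ⟨s, U ∩ cyl (dom s.1), fun χ hχ => hχ.2,
      hU.inter (isClopen_cyl (dom_mem_Ebar s.2)).isOpen, ?_⟩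
  ext γ
  constructor
  · rintro ⟨χ, h, hχ, rfl⟩; exact ⟨χ, ⟨hχ, h⟩, rfl⟩
  · rintro ⟨χ, hχ, rfl⟩; exact ⟨χ, hχ.2, hχ.1, rfl⟩

theorem Germ.exists_rep (γ : Germ P) : ∃ s χ h, γ = Germ.mk s χ h := by
  induction γ using Quotient.inductionOn with | _ p
  exact ⟨p.s, p.χ, p.h, rfl⟩

theorem continuous_src : Continuous (Germ.src : Germ P → Omega P) := by
  refine continuous_def.2 fun U hU => ?_
  have : (Germ.src : Germ P → Omega P) ⁻¹' U = ⋃ s, bis s U := by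
    ext γ
    simp only [mem_preimage, mem_iUnion]
    constructor
    · obtain ⟨s, χ, h, rfl⟩ := γ.exists_rep
      exact fun hU => ⟨s, χ, h, hU, rfl⟩
    · rintro ⟨s, χ, h, hU, rfl⟩; exact hU
  rw [this]
  exact isOpen_iUnion fun s => isOpen_bis s hU

/-- An equality of germs at `χ` is witnessed by a set `A`, and the same witness works at all
characters of `cyl A`. -/
theorem continuous_germ (s : HullBar P) :
    Continuous fun χ : cyl (dom s.1) => Germ.mk s χ.1 χ.2 := by
  refine continuous_generateFrom_iff.2 ?_
  rintro _ ⟨t, U, hU, hUo, rfl⟩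
  refine isOpen_iff_mem_nhds.2 ?_
  rintro ⟨χ, hχ⟩ ⟨ψ, hψ, e⟩
  obtain rfl : χ = ψ := congrArg Germ.src e
  obtain ⟨A, hA, h1, h2⟩ := germ_eq.1 e
  have hW : IsOpen (U ∩ cyl A) := hUo.inter (isClopen_cyl hA).isOpen
  refine Filter.mem_of_superset ((hW.preimage continuous_subtype_val).mem_nhds ⟨hψ, h1⟩) ?_
  rintro ⟨ψ, hψs⟩ ⟨hψU, hψA⟩
  exact ⟨ψ, hψU, germ_eq.2 ⟨A, hA, hψA, h2⟩⟩

theorem isCompact_bis (s : HullBar P) : IsCompact (bis s univ) := by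
  have : bis s univ = range fun χ : cyl (dom s.1) => Germ.mk s χ.1 χ.2 := by
    ext γ
    constructor
    · rintro ⟨χ, h, -, rfl⟩; exact ⟨⟨χ, h⟩, rfl⟩
    · rintro ⟨χ, rfl⟩; exact ⟨χ.1, χ.2, trivial, rfl⟩
  rw [this]
  have : CompactSpace (cyl (dom s.1)) :=
    isCompact_iff_compactSpace.1 (isClopen_cyl (dom_mem_Ebar s.2)).isClosed.isCompact
  exact isCompact_range (continuous_germ s)

/-- The groupoid is Hausdorff as soon as elements of the enlarged hull that agree somewhere agree
on their common domain. -/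
theorem t2Space_germ (h : ∀ s t : HullBar P, ∀ x y, y ∈ s.1 x → y ∈ t.1 x →
    ∀ x' ∈ dom s.1 ∩ dom t.1, ∀ y', y' ∈ s.1 x' ↔ y' ∈ t.1 x') : T2Space (Germ P) := by
  refine ⟨fun γ β hγβ => ?_⟩
  obtain ⟨s, χ, hs, rfl⟩ := γ.exists_rep
  obtain ⟨t, ψ, ht, rfl⟩ := β.exists_rep
  by_cases hχψ : χ = ψ
  · subst hχψ
    -- Agreement of `s` and `t` on a nonempty part of their domains would spread to the whole common
    -- domain by `h`, and the two germs at `χ` would coincide. So the bisections of `s` and `t` do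
    -- not meet.
    have hst : ∀ A ∈ Ebar P, A ⊆ dom s.1 → ∀ ω : Omega P, ω.OnBar A →
        ¬ ∀ x ∈ A, ∀ y, y ∈ s.1 x ↔ y ∈ t.1 x := by
      intro A hA hAs ω hω hA'
      obtain ⟨x, hx⟩ := onBar_nonempty hA hω
      obtain ⟨y, hy⟩ := hAs hx
      exact hγβ (germ_eq.2 ⟨_, inter_mem_Ebar (dom_mem_Ebar s.2) (dom_mem_Ebar t.2),
        χ.onBar_inter (dom_mem_Ebar s.2) (dom_mem_Ebar t.2) hs ht,
        h s t x y hy ((hA' x hx y).1 hy)⟩)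
    refine ⟨_, _, isOpen_bis s isOpen_univ, isOpen_bis t isOpen_univ, ⟨χ, hs, trivial, rfl⟩,
      ⟨χ, ht, trivial, rfl⟩, ?_⟩
    refine disjoint_left.2 ?_
    rintro _ ⟨ω, hω, -, rfl⟩ ⟨ω', hω', -, e⟩
    obtain rfl : ω = ω' := congrArg Germ.src e
    obtain ⟨A, hA, h1, h2⟩ := germ_eq.1 e
    exact hst _ (inter_mem_Ebar hA (dom_mem_Ebar s.2)) inter_subset_right ω
      (ω.onBar_inter hA (dom_mem_Ebar s.2) h1 hω) fun x hx => h2 x hx.1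
  · obtain ⟨U, V, hU, hV, h1, h2, h3⟩ := t2_separation hχψ
    exact ⟨_, _, hU.preimage continuous_src, hV.preimage continuous_src, h1, h2, h3.preimage _⟩

/-! ### The action of the hull on germs -/

open Classical in
/-- A partial bijection, from its graph. -/
noncomputable def pequivOfRel {X : Type u} (R : X → X → Prop)
    (h1 : ∀ x y z, R x y → R x z → y = z) (h2 : ∀ x y z, R x z → R y z → x = y) : X ≃. X where
  toFun x := if h : ∃ y, R x y then some h.choose else none
  invFun y := if h : ∃ x, R x y then some h.choose else none
  inv x y := by
    have aux : ∀ (Q : X → Prop) (z : X), (∀ u v, Q u → Q v → u = v) →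
        ((if h : ∃ y, Q y then some h.choose else none) = some z ↔ Q z) := by
      intro Q z hQ
      split_ifs with h
      · rw [Option.some_inj]
        exact ⟨fun e => e ▸ h.choose_spec, fun hz => hQ _ _ h.choose_spec hz⟩
      · simp only [false_iff]
        exact fun hz => h ⟨z, hz⟩
    exact (aux (fun x => R x y) x fun u v => h2 u v y).trans
      (aux (fun y => R x y) y fun u v => h1 x u v).symm

theorem mem_pequivOfRel {X : Type u} {R : X → X → Prop} {h1 h2} {x y : X} :
    y ∈ pequivOfRel R h1 h2 x ↔ R x y := by
  classical
  change (if h : ∃ y, R x y then some h.choose else none) = some y ↔ _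
  split_ifs with h
  · rw [Option.some_inj]
    exact ⟨fun e => e ▸ h.choose_spec, fun hz => h1 _ _ _ h.choose_spec hz⟩
  · simp only [false_iff]
    exact fun hz => h ⟨y, hz⟩

/-- `γ = [s t, χ]` and `β = [t, χ]`. -/
def LeftRel (s : HullBar P) (β γ : Germ P) : Prop :=
  ∃ t χ ht h, β = Germ.mk t χ ht ∧ γ = Germ.mk (s.mul t) χ h

theorem dom_mul_subset (s t : HullBar P) : dom (s.mul t).1 ⊆ dom t.1 := by
  rintro x ⟨z, hz⟩
  obtain ⟨y, hy, -⟩ := mem_pmul.1 hz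
  exact ⟨y, hy⟩

/-- The left action is independent of the representative: if `t` and `t'` agree on `A`, so do `s t`
and `s t'`, and the domain condition transfers along `A`. -/
theorem leftRel_mk {s t : HullBar P} {χ : Omega P} {ht : χ.OnBar (dom t.1)} {γ : Germ P} :
    LeftRel s (Germ.mk t χ ht) γ ↔ ∃ h, γ = Germ.mk (s.mul t) χ h := by
  constructor
  · rintro ⟨t', χ', ht', h, e, rfl⟩
    obtain rfl : χ = χ' := congrArg Germ.src e
    obtain ⟨A, hA, h1, h2⟩ := germ_eq.1 e
    have key : ∀ x ∈ A, ∀ y, y ∈ (s.mul t).1 x ↔ y ∈ (s.mul t').1 x := by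
      intro x hx y
      change y ∈ pmul s.1 t.1 x ↔ y ∈ pmul s.1 t'.1 x
      rw [mem_pmul, mem_pmul]
      exact exists_congr fun z => and_congr_left fun _ => h2 x hx z
    have hd : χ.OnBar (dom (s.mul t).1) := by
      refine onBar_mono (inter_mem_Ebar hA (dom_mem_Ebar (s.mul t').2)) (dom_mem_Ebar (s.mul t).2)
        ?_ (χ.onBar_inter hA (dom_mem_Ebar (s.mul t').2) h1 h)
      rintro x ⟨hx, y, hy⟩
      exact ⟨y, (key x hx y).2 hy⟩
    exact ⟨hd, germ_eq.2 ⟨A, hA, h1, fun x hx y => (key x hx y).symm⟩⟩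
  · rintro ⟨h, rfl⟩; exact ⟨t, χ, ht, h, rfl, rfl⟩

/-- The partial bijection `[t, χ] ↦ [s t, χ]` of the groupoid. -/
noncomputable def lact (s : HullBar P) : Germ P ≃. Germ P :=
  pequivOfRel (LeftRel s)
    (by
      intro β γ γ' h h'
      obtain ⟨t, χ, ht, rfl⟩ := β.exists_rep
      obtain ⟨_, rfl⟩ := leftRel_mk.1 h
      obtain ⟨_, rfl⟩ := leftRel_mk.1 h'
      rfl)
    (by
      -- Injectivity: `s` is cancelled from `s t = s t'`. This is possible only where `s t` is
      -- defined, so the witness `A` is cut down to that domain.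
      rintro _ _ γ ⟨t, χ, ht, h, rfl, rfl⟩ ⟨t', χ', ht', h', rfl, e⟩
      obtain rfl : χ = χ' := congrArg Germ.src e
      obtain ⟨A, hA, h1, h2⟩ := germ_eq.1 e
      refine germ_eq.2 ⟨A ∩ dom (s.mul t).1, inter_mem_Ebar hA (dom_mem_Ebar (s.mul t).2),
        χ.onBar_inter hA (dom_mem_Ebar (s.mul t).2) h1 h, ?_⟩
      rintro x ⟨hx, z, hz⟩
      obtain ⟨y, hy, hyz⟩ := mem_pmul.1 hz
      obtain ⟨y', hy', hyz'⟩ := mem_pmul.1 ((h2 x hx z).1 hz)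
      obtain rfl := s.1.inj hyz hyz'
      exact fun w => ⟨fun hw => mem_unique hw hy ▸ hy', fun hw => mem_unique hw hy' ▸ hy⟩)

theorem mem_lact {s : HullBar P} {β γ : Germ P} : γ ∈ lact s β ↔ LeftRel s β γ := mem_pequivOfRel

theorem mem_lact_mk {s t : HullBar P} {χ : Omega P} {ht : χ.OnBar (dom t.1)} {γ : Germ P} :
    γ ∈ lact s (Germ.mk t χ ht) ↔ ∃ h, γ = Germ.mk (s.mul t) χ h :=
  mem_lact.trans leftRel_mk

theorem hullBar_mul_assoc (s t r : HullBar P) : (s.mul t).mul r = s.mul (t.mul r) :=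
  Subtype.ext (PEquiv.trans_assoc _ _ _).symm

theorem lact_mul (s t : HullBar P) : pmul (lact s) (lact t) = lact (s.mul t) := by
  refine pext fun β γ => ?_
  obtain ⟨r, χ, hr, rfl⟩ := β.exists_rep
  rw [mem_pmul, mem_lact_mk, hullBar_mul_assoc]
  constructor
  · rintro ⟨α, hα, h⟩
    obtain ⟨_, rfl⟩ := mem_lact_mk.1 hα
    exact mem_lact_mk.1 h
  · rintro ⟨h, rfl⟩
    have h' := onBar_mono (dom_mem_Ebar (s.mul (t.mul r)).2) (dom_mem_Ebar (t.mul r).2)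
      (dom_mul_subset _ _) h
    exact ⟨_, mem_lact_mk.2 ⟨h', rfl⟩, mem_lact_mk.2 ⟨h, rfl⟩⟩

theorem mem_lact_inv {s : HullBar P} {β γ : Germ P} (h : γ ∈ lact s β) : β ∈ lact s.inv γ := by
  obtain ⟨t, χ, ht, hd, rfl, rfl⟩ := mem_lact.1 h
  have key : ∀ x ∈ dom (s.mul t).1, ∀ y, y ∈ t.1 x ↔ y ∈ (s.inv.mul (s.mul t)).1 x := by
    rintro x ⟨z, hz⟩ y
    obtain ⟨w, hw, hwz⟩ := mem_pmul.1 hz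
    change y ∈ t.1 x ↔ y ∈ pmul s.1.symm (s.mul t).1 x
    rw [mem_pmul]
    constructor
    · intro hy
      obtain rfl := mem_unique hy hw
      exact ⟨z, hz, (PEquiv.mem_iff_mem s.1).2 hwz⟩
    · rintro ⟨z', hz', hy⟩
      obtain rfl := mem_unique hz hz'
      rwa [s.1.inj ((PEquiv.mem_iff_mem s.1).1 hy) hwz]
  refine mem_lact_mk.2 ⟨onBar_mono (dom_mem_Ebar (s.mul t).2)
    (dom_mem_Ebar (s.inv.mul (s.mul t)).2) ?_ hd,
    germ_eq.2 ⟨_, dom_mem_Ebar (s.mul t).2, hd, key⟩⟩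
  · intro x hx
    obtain ⟨y, hy⟩ := dom_mul_subset s t hx
    exact ⟨y, (key x hx y).1 hy⟩

theorem lact_symm (s : HullBar P) : (lact s).symm = lact s.inv := by
  refine pext fun γ β => ?_
  rw [PEquiv.mem_iff_mem]
  refine ⟨mem_lact_inv, fun h => ?_⟩
  have := mem_lact_inv h
  rwa [show s.inv.inv = s from Subtype.ext (PEquiv.symm_symm s.1)] at this

theorem mk_mul_inv {r t : HullBar P} {χ : Omega P} {hr : χ.OnBar (dom r.1)}
    {ht : χ.OnBar (dom t.1)} (h : (Germ.mk r χ hr).src = (Germ.mk t χ ht).inv.tgt) :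
    ∃ h', (Germ.mk r χ hr).mul (Germ.mk t χ ht).inv h = Germ.mk (r.mul t.inv) (act t χ ht) h' := by
  -- The target of the inverse germ is `χ` only up to a proved equality, so the domain condition for
  -- `r` is transported before the product formula applies.
  have key : act t.inv (act t χ ht) (onBar_dom_inv ht) = χ := (Germ.mk t χ ht).tgt_inv
  have hr' : (act t.inv (act t χ ht) (onBar_dom_inv ht)).OnBar (dom r.1) := by rwa [key]
  refine ⟨onBar_dom_mul (onBar_dom_inv ht) hr', ?_⟩
  refine (exists_mul _ _ h).choose_spec r t.inv (act t χ ht) (onBar_dom_inv ht) hr' ?_ rfl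
  congr 1

/-- This links the left action to convolution: the matrix of `lact s` at `(γ, β)` tests whether `γ
β⁻¹` is a germ of `s`, which is the convolution kernel of the indicator of the bisection. -/
theorem mem_lact_iff {s : HullBar P} {β γ : Germ P} :
    γ ∈ lact s β ↔ ∃ h : γ.src = β.src,
      γ.mul β.inv (h.trans β.tgt_inv.symm) ∈ bis s univ := by
  obtain ⟨t, χ, ht, rfl⟩ := β.exists_rep
  constructor
  · intro h
    obtain ⟨hst, rfl⟩ := mem_lact_mk.1 h
    refine ⟨rfl, ?_⟩
    obtain ⟨h', e⟩ := mk_mul_inv (hr := hst) (ht := ht) (Germ.mk t χ ht).tgt_inv.symm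
    rw [e]
    have key : ∀ x y, y ∈ ((s.mul t).mul t.inv).1 x → y ∈ s.1 x := by
      intro x y h
      obtain ⟨z, hz, hzy⟩ := mem_pmul.1 h
      obtain ⟨w, hw, hwy⟩ := mem_pmul.1 hzy
      obtain rfl := mem_unique ((PEquiv.mem_iff_mem t.1).1 hz) hw
      exact hwy
    refine ⟨_, onBar_mono (dom_mem_Ebar ((s.mul t).mul t.inv).2) (dom_mem_Ebar s.2) ?_ h', trivial,
      germ_eq.2 ⟨_, dom_mem_Ebar ((s.mul t).mul t.inv).2, h', ?_⟩⟩
    · rintro x ⟨y, hy⟩; exact ⟨y, key x y hy⟩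
    · rintro x ⟨z, hz⟩ y
      exact ⟨key x y, fun hy => mem_unique hy (key x z hz) ▸ hz⟩
  · obtain ⟨r, ψ, hr, rfl⟩ := γ.exists_rep
    rintro ⟨h, hb⟩
    obtain rfl : ψ = χ := h
    obtain ⟨h', e⟩ := mk_mul_inv (hr := hr) (ht := ht) (Germ.mk t ψ ht).tgt_inv.symm
    rw [e] at hb
    obtain ⟨ω, hω, -, e'⟩ := hb
    obtain rfl : act t ψ ht = ω := congrArg Germ.src e'
    obtain ⟨A, hA, h1, h2⟩ := germ_eq.1 e'
    rw [act_onBar hA] at h1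
    have hB := pull_mem_Ebar t.2 hA
    have key : ∀ x ∈ pull t.1 A, ∀ y, y ∈ r.1 x ↔ y ∈ (s.mul t).1 x := by
      rintro x ⟨w, hw, hxw⟩ y
      change _ ↔ y ∈ pmul s.1 t.1 x
      rw [mem_pmul]
      have : y ∈ r.1 x ↔ y ∈ (r.mul t.inv).1 w := by
        change _ ↔ y ∈ pmul r.1 t.1.symm w
        rw [mem_pmul]
        constructor
        · exact fun hy => ⟨x, (PEquiv.mem_iff_mem t.1).2 hxw, hy⟩
        · rintro ⟨x', hx', hy⟩
          rwa [← t.1.inj ((PEquiv.mem_iff_mem t.1).1 hx') hxw]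
      rw [this, h2 w hw]
      constructor
      · exact fun hy => ⟨w, hxw, hy⟩
      · rintro ⟨w', hw', hy⟩
        rwa [mem_unique hxw hw']
    have hC := inter_mem_Ebar hB (dom_mem_Ebar r.2)
    refine mem_lact_mk.2 ⟨onBar_mono hC (dom_mem_Ebar (s.mul t).2) ?_
      (ψ.onBar_inter hB (dom_mem_Ebar r.2) h1 hr), germ_eq.2 ⟨_, hB, h1, key⟩⟩
    rintro x ⟨hx, y, hy⟩
    exact ⟨y, (key x hx y).1 hy⟩

theorem src_mul_inv {β γ : Germ P} (h : γ.src = β.src) :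
    (γ.mul β.inv (h.trans β.tgt_inv.symm)).src = β.tgt := by
  obtain ⟨t, χ, ht, rfl⟩ := β.exists_rep
  obtain ⟨r, ψ, hr, rfl⟩ := γ.exists_rep
  obtain rfl : ψ = χ := h
  obtain ⟨h', e⟩ := mk_mul_inv (hr := hr) (ht := ht) (Germ.mk t ψ ht).tgt_inv.symm
  rw [e]
  rfl

/-- The idempotent of the enlarged hull attached to an element of the Boolean closure. -/
noncomputable def HullBar.idem (A : Set P) (hA : A ∈ Ebar P) : HullBar P :=
  ⟨partialId A, leftMul 1, A, .leftMul 1, hA, fun x _ => ⟨1 * x, mem_leftMul.2 rfl⟩, by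
    refine pext fun x y => ?_
    simp only [mem_pmul, mem_leftMul, one_mul]
    exact ⟨fun h => ⟨y, h, rfl⟩, fun ⟨z, h, e⟩ => e ▸ h⟩⟩

theorem mem_lact_idem {A : Set P} {hA : A ∈ Ebar P} {β γ : Germ P} :
    γ ∈ lact (HullBar.idem A hA) β ↔ γ = β ∧ β.tgt.OnBar A := by
  obtain ⟨t, χ, ht, rfl⟩ := β.exists_rep
  have hB := pull_mem_Ebar t.2 hA
  have key : ∀ x y, y ∈ ((HullBar.idem A hA).mul t).1 x ↔ y ∈ t.1 x ∧ y ∈ A := by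
    intro x y
    change y ∈ pmul (partialId A) t.1 x ↔ _
    simp only [mem_pmul, mem_partialId]
    exact ⟨fun ⟨z, h, e, hz⟩ => e ▸ ⟨h, hz⟩, fun h => ⟨y, h.1, rfl, h.2⟩⟩
  have hd : dom ((HullBar.idem A hA).mul t).1 = pull t.1 A := by
    ext x
    exact exists_congr fun y => (key x y).trans and_comm
  have htgt : (Germ.mk t χ ht).tgt.OnBar A ↔ χ.OnBar (pull t.1 A) := act_onBar (h := ht) hA
  have hger : ∀ h, Germ.mk ((HullBar.idem A hA).mul t) χ h = Germ.mk t χ ht := by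
    intro h
    refine germ_eq.2 ⟨_, hB, hd ▸ h, ?_⟩
    rintro x ⟨z, hz, hxz⟩ y
    rw [key]
    exact ⟨fun h => h.1, fun h => ⟨h, mem_unique hxz h ▸ hz⟩⟩
  rw [mem_lact_mk, htgt]
  constructor
  · rintro ⟨h, rfl⟩
    exact ⟨hger h, hd ▸ h⟩
  · rintro ⟨rfl, h⟩
    exact ⟨hd.symm ▸ h, (hger _).symm⟩

/-! ### The convolution operators of compact open bisections -/

/-- The partial isometry attached to an element of the enlarged hull, i.e. the operator of
convolution by the characteristic function of the bisection of its germs. -/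
noncomputable def hullOp (s : HullBar P) : L2 P →L[ℂ] L2 P := shift (lact s)

theorem hullOp_mul (s t : HullBar P) : hullOp s * hullOp t = hullOp (s.mul t) := by
  rw [hullOp, hullOp, shift_mul, lact_mul, hullOp]

theorem star_hullOp (s : HullBar P) : star (hullOp s) = hullOp s.inv := by
  rw [hullOp, star_shift, lact_symm, hullOp]

open Classical in
theorem hullOp_single (s : HullBar P) (γ β : Germ P) :
    (hullOp s (lp.single 2 β (1 : ℂ)) : L2 P) γ = if γ ∈ lact s β then 1 else 0 :=
  shift_single _ _ _

theorem hullOp_idem_apply {A : Set P} {hA : A ∈ Ebar P} (ξ : L2 P) (β : Germ P)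
    [Decidable (β.tgt.OnBar A)] :
    (hullOp (HullBar.idem A hA) ξ : L2 P) β = if β.tgt.OnBar A then ξ β else 0 := by
  change shiftFun _ _ _ = _
  split_ifs with h
  · exact shiftFun_of_mem (mem_lact_idem.2 ⟨rfl, h⟩)
  · refine shiftFun_of_not_mem fun γ hγ => h ?_
    obtain ⟨rfl, h'⟩ := mem_lact_idem.1 hγ
    exact h'

theorem isConvolution_hullOp (s : HullBar P) :
    IsConvolution ((bis s univ).indicator fun _ => 1) (hullOp s) := by
  classical
  intro γ β
  rw [hullOp_single]
  by_cases h : γ.src = β.src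
  · rw [dif_pos h]
    by_cases hb : γ.mul β.inv (h.trans β.tgt_inv.symm) ∈ bis s univ
    · rw [indicator_of_mem hb, if_pos (mem_lact_iff.2 ⟨h, hb⟩)]
    · rw [indicator_of_notMem hb, if_neg fun h' => hb (mem_lact_iff.1 h').2]
  · rw [dif_neg h, if_neg fun h' => h (mem_lact_iff.1 h').1]

theorem IsConvolution.unique {f : Germ P → ℂ} {S T : L2 P →L[ℂ] L2 P} (hS : IsConvolution f S)
    (hT : IsConvolution f T) : S = T := by
  classical
  exact clm_ext_single fun γ β => (hS γ β).trans (hT γ β).symm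

theorem IsConvolution.add {f g : Germ P → ℂ} {S T : L2 P →L[ℂ] L2 P} (hS : IsConvolution f S)
    (hT : IsConvolution g T) : IsConvolution (f + g) (S + T) := by
  classical
  intro γ β
  refine Eq.trans (b := (S (lp.single 2 β (1 : ℂ)) : L2 P) γ +
    (T (lp.single 2 β (1 : ℂ)) : L2 P) γ) rfl ?_
  rw [hS, hT]
  split_ifs
  · rfl
  · exact add_zero 0

theorem isClopen_bis [T2Space (Germ P)] (s : HullBar P) : IsClopen (bis s univ) :=
  ⟨(isCompact_bis s).isClosed, isOpen_bis s isOpen_univ⟩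

/-- In a Hausdorff groupoid a compact open bisection is clopen, so its indicator is a continuous
function with compact support. -/
theorem hullOp_mem_reducedCStar [T2Space (Germ P)] {s : HullBar P} {H : Set (Germ P)}
    (h : bis s univ ⊆ H) : hullOp s ∈ reducedCStar H := by
  have hs : tsupport ((bis s univ).indicator fun _ => (1 : ℂ)) ⊆ bis s univ :=
    closure_minimal support_indicator_subset (isClopen_bis s).isClosed
  refine NonUnitalStarSubalgebra.le_topologicalClosure _
    (NonUnitalStarAlgebra.subset_adjoin ℂ _ ⟨_, ?_, ?_, hs.trans h, isConvolution_hullOp s⟩)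
  · exact continuous_const.indicator fun x hx => by
      rw [(isClopen_bis s).frontier_eq] at hx
      exact hx.elim
  · exact (isCompact_bis s).of_isClosed_subset (isClosed_tsupport _) hs

/-- The C*-algebra generated by the operators `hullOp s`. -/
noncomputable def hullAlgebra (P : Type u) [Monoid P] [IsLeftCancelMul P] :
    NonUnitalStarSubalgebra ℂ (L2 P →L[ℂ] L2 P) :=
  (NonUnitalStarAlgebra.adjoin ℂ (range (hullOp (P := P)))).topologicalClosure

theorem hullOp_mem_hullAlgebra (s : HullBar P) : hullOp s ∈ hullAlgebra P :=
  NonUnitalStarSubalgebra.le_topologicalClosure _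
    (NonUnitalStarAlgebra.subset_adjoin ℂ _ ⟨s, rfl⟩)

/-- By compactness and total disconnectedness of Ω, `g` is a uniform limit of combinations of
indicators of clopen sets. These sets are cylinders, and their indicators act as the operators of
idempotents. -/
theorem exists_mulOp_mem_hullAlgebra {g : Omega P → ℂ} (hg : Continuous g) :
    ∃ T ∈ hullAlgebra P, ∀ (ξ : L2 P) (β : Germ P), (T ξ : L2 P) β = g β.tgt * ξ β := by
  classical
  obtain ⟨C, hC⟩ := isCompact_univ.exists_bound_of_continuousOn hg.continuousOn
  obtain ⟨T, -, hT⟩ := exists_mulOp (C := |C|) (abs_nonneg C) (fun β : Germ P => g β.tgt)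
    fun β => (hC _ trivial).trans (le_abs_self C)
  refine ⟨T, ?_, hT⟩
  change T ∈ closure _
  refine Metric.mem_closure_iff.2 fun ε hε => ?_
  -- Half of `ε` is taken because the multiplication operator is only bounded by `≤`, while the
  -- closure needs a strict inequality.
  have hS : {p : ℂ × ℂ | dist p.1 p.2 < ε / 2} ∈ nhdsSet (diagonal ℂ) := by
    refine (isOpen_lt continuous_dist continuous_const).mem_nhdsSet.2 ?_
    rintro ⟨x, y⟩ (rfl : x = y)
    simpa using hε
  obtain ⟨n, U, v, hUv⟩ :=
    ContinuousMap.exists_finite_sum_const_indicator_approximation_of_mem_nhds_diagonal ⟨g, hg⟩ hS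
  choose A hA hUA using fun i => exists_eq_cyl (U i).isClopen
  refine ⟨∑ i, v i • hullOp (HullBar.idem (A i) (hA i)),
    sum_mem fun i _ => SMulMemClass.smul_mem _ (NonUnitalStarAlgebra.subset_adjoin ℂ _ ⟨_, rfl⟩), ?_⟩
  obtain ⟨R, hR, hR'⟩ := exists_mulOp (C := ε / 2) (by positivity)
    (fun β : Germ P => g β.tgt - ∑ i, indicator (U i) (fun _ => v i) β.tgt) fun β => by
      rw [← dist_eq_norm]
      exact (hUv β.tgt).le
  have : T - ∑ i, v i • hullOp (HullBar.idem (A i) (hA i)) = R := by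
    refine ContinuousLinearMap.ext fun ξ => lp.ext (funext fun β => ?_)
    rw [hR', sub_apply, lp.coeFn_sub, Pi.sub_apply, hT, sub_mul,
      sum_apply, lp.coeFn_sum, Finset.sum_apply, Finset.sum_mul]
    congr 1
    refine Finset.sum_congr rfl fun i _ => ?_
    rw [smul_apply, lp.coeFn_smul, Pi.smul_apply, hullOp_idem_apply, hUA i,
      indicator_apply]
    by_cases h : β.tgt.OnBar (A i)
    · rw [if_pos h, if_pos (show β.tgt ∈ cyl (A i) from h), smul_eq_mul]
    · rw [if_neg h, if_neg (show β.tgt ∉ cyl (A i) from h), smul_zero, zero_mul]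
  rw [dist_eq_norm, this]
  linarith

/-- On a single bisection `f` is a function of the source, so its convolution operator factors as
`hullOp s` after multiplication by `g χ = f [s, χ]`. Extending `g` by zero keeps it continuous
because the domain is clopen. -/
theorem exists_convolution_of_bis {s : HullBar P} {f : Germ P → ℂ} (hf : Continuous f)
    (hfs : ∀ γ, γ ∉ bis s univ → f γ = 0) : ∃ T ∈ hullAlgebra P, IsConvolution f T := by
  classical
  set g : Omega P → ℂ := fun χ => if h : χ.OnBar (dom s.1) then f (Germ.mk s χ h) else 0 with hg
  have hcl := isClopen_cyl (dom_mem_Ebar s.2)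
  have hgc : Continuous g := by
    refine continuous_iff_continuousAt.2 fun χ => ?_
    by_cases h : χ.OnBar (dom s.1)
    · refine ContinuousOn.continuousAt ?_ (hcl.isOpen.mem_nhds h)
      refine continuousOn_iff_continuous_domRestrict.2 ?_
      have : (cyl (dom s.1)).domRestrict g = fun χ => f (Germ.mk s χ.1 χ.2) := by
        funext ψ
        exact dif_pos ψ.2
      rw [this]
      exact hf.comp (continuous_germ s)
    · refine ContinuousOn.continuousAt (f := g) ?_ (hcl.compl.isOpen.mem_nhds h)
      refine (continuousOn_const (c := (0 : ℂ))).congr fun ψ hψ => dif_neg hψ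
  obtain ⟨M, hM, hMg⟩ := exists_mulOp_mem_hullAlgebra hgc
  refine ⟨hullOp s * M, mul_mem (hullOp_mem_hullAlgebra s) hM, fun γ β => ?_⟩
  have h1 : M (lp.single 2 β (1 : ℂ)) = g β.tgt • lp.single 2 β (1 : ℂ) := by
    refine lp.ext (funext fun α => ?_)
    rw [hMg, lp.coeFn_smul, Pi.smul_apply, smul_eq_mul, lp.single_apply]
    by_cases h : α = β
    · rw [h]
    · rw [Pi.single_eq_of_ne h, mul_zero, mul_zero]
  rw [mul_apply_eq_comp, h1, map_smul, lp.coeFn_smul, Pi.smul_apply, hullOp_single]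
  by_cases h : γ.src = β.src
  · rw [dif_pos h]
    by_cases hb : γ.mul β.inv (h.trans β.tgt_inv.symm) ∈ bis s univ
    · rw [if_pos (mem_lact_iff.2 ⟨h, hb⟩)]
      obtain ⟨χ, hχ, -, e⟩ := hb
      have hχβ : χ = β.tgt := (congrArg Germ.src e).symm.trans (src_mul_inv h)
      subst hχβ
      rw [e, smul_eq_mul, mul_one]
      exact dif_pos hχ
    · rw [if_neg fun h' => hb (mem_lact_iff.1 h').2, smul_zero, hfs _ hb]
  · rw [dif_neg h, if_neg fun h' => h (mem_lact_iff.1 h').1, smul_zero]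

/-- The bisections are clopen, so `f` can be split off along one of them at a time without losing
continuity. -/
theorem exists_convolution_of_biUnion_bis [T2Space (Germ P)] (S : Finset (HullBar P)) :
    ∀ f : Germ P → ℂ, Continuous f → (∀ γ, γ ∉ ⋃ s ∈ S, bis s univ → f γ = 0) →
      ∃ T ∈ hullAlgebra P, IsConvolution f T := by
  classical
  induction S using Finset.induction_on with
  | empty =>
    intro f _ hfS
    refine ⟨0, zero_mem _, fun γ β => ?_⟩
    have hf0 : f = 0 := funext fun γ => hfS γ (by simp)
    subst hf0
    split_ifs <;> rfl
  | insert s S _ ih =>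
    intro f hf hfS
    have hc := isClopen_bis s
    obtain ⟨T, hT, hT'⟩ := exists_convolution_of_bis (s := s) (f := (bis s univ).indicator f)
      (hf.indicator fun x hx => by rw [hc.frontier_eq] at hx; exact hx.elim)
      fun γ hγ => indicator_of_notMem hγ f
    obtain ⟨R, hR, hR'⟩ := ih ((bis s univ)ᶜ.indicator f)
      (hf.indicator fun x hx => by rw [hc.compl.frontier_eq] at hx; exact hx.elim)
      fun γ hγ => by
        by_cases h : γ ∈ bis s univ
        · exact indicator_of_notMem (notMem_compl_iff.2 h) f
        · rw [indicator_of_mem h]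
          refine hfS γ fun h' => ?_
          rw [Finset.set_biUnion_insert] at h'
          exact h'.elim h hγ
    refine ⟨T + R, add_mem hT hR, ?_⟩
    have := hT'.add hR'
    rwa [indicator_self_add_compl] at this

theorem convolution_mem_hullAlgebra [T2Space (Germ P)] {f : Germ P → ℂ} {T : L2 P →L[ℂ] L2 P}
    (hf : Continuous f) (hfc : HasCompactSupport f) (hT : IsConvolution f T) :
    T ∈ hullAlgebra P := by
  obtain ⟨S, hS⟩ := hfc.elim_finite_subcover (fun s : HullBar P => bis s univ)
    (fun s => isOpen_bis s isOpen_univ) fun γ _ => by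
      obtain ⟨s, χ, h, rfl⟩ := γ.exists_rep
      exact mem_iUnion.2 ⟨s, χ, h, trivial, rfl⟩
  obtain ⟨R, hR, hR'⟩ := exists_convolution_of_biUnion_bis S f hf
    fun γ hγ => image_eq_zero_of_notMem_tsupport fun h => hγ (hS h)
  rwa [hT.unique hR']

theorem reducedCStar_le_hullAlgebra [T2Space (Germ P)] (H : Set (Germ P)) :
    reducedCStar H ≤ hullAlgebra P := by
  refine NonUnitalStarSubalgebra.topologicalClosure_minimal _ (NonUnitalStarAlgebra.adjoin_le ?_)
    (NonUnitalStarSubalgebra.isClosed_topologicalClosure _)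
  rintro T ⟨f, h1, h2, -, h3⟩
  exact convolution_mem_hullAlgebra h1 h2 h3

/-- The operators `hullOp s` are closed under products and adjoints, so their linear span is already
a *-algebra. -/
theorem adjoin_hullOp_le_span {T : L2 P →L[ℂ] L2 P}
    (hT : T ∈ NonUnitalStarAlgebra.adjoin ℂ (range (hullOp (P := P)))) :
    T ∈ Submodule.span ℂ (range (hullOp (P := P))) := by
  induction hT using NonUnitalStarAlgebra.adjoin_induction with
  | mem x hx => exact Submodule.subset_span hx
  | add x y _ _ hx hy => exact add_mem hx hy
  | zero => exact zero_mem _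
  | mul x y hx' hy' hx hy =>
    clear hx' hy'
    induction hx using Submodule.span_induction with
    | mem x hx =>
      obtain ⟨s, rfl⟩ := hx
      induction hy using Submodule.span_induction with
      | mem y hy =>
        obtain ⟨t, rfl⟩ := hy
        exact Submodule.subset_span ⟨s.mul t, (hullOp_mul s t).symm⟩
      | zero => rw [mul_zero]; exact zero_mem _
      | add y z _ _ hy hz => rw [mul_add]; exact add_mem hy hz
      | smul c y _ hy => rw [mul_smul_comm]; exact Submodule.smul_mem _ c hy
    | zero => rw [zero_mul]; exact zero_mem _
    | add x z _ _ hx hz => rw [add_mul]; exact add_mem hx hz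
    | smul c x _ hx => rw [smul_mul_assoc]; exact Submodule.smul_mem _ c hx
  | smul c x _ hx => exact Submodule.smul_mem _ c hx
  | star x hx' hx =>
    clear hx'
    induction hx using Submodule.span_induction with
    | mem x hx =>
      obtain ⟨s, rfl⟩ := hx
      exact Submodule.subset_span ⟨s.inv, (star_hullOp s).symm⟩
    | zero => rw [star_zero]; exact zero_mem _
    | add x z _ _ hx hz => rw [star_add]; exact add_mem hx hz
    | smul c x _ hx => rw [star_smul]; exact Submodule.smul_mem _ _ hx

/-- A property that passes to linear combinations and norm limits holds on the reduced C*-algebra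
if it holds for the operators `hullOp s`. -/
theorem reducedCStar_induction [T2Space (Germ P)] {p : (L2 P →L[ℂ] L2 P) → Prop}
    (hull : ∀ s, p (hullOp s)) (zero : p 0) (add : ∀ S T, p S → p T → p (S + T))
    (smul : ∀ (c : ℂ) T, p T → p (c • T))
    (lim : ∀ T, (∀ ε > 0, ∃ S, p S ∧ ‖T - S‖ ≤ ε) → p T) {H : Set (Germ P)}
    {T : L2 P →L[ℂ] L2 P} (hT : T ∈ reducedCStar H) : p T := by
  have hT' : T ∈ closure (NonUnitalStarAlgebra.adjoin ℂ (range (hullOp (P := P))) : Set _) :=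
    reducedCStar_le_hullAlgebra H hT
  refine lim T fun ε hε => ?_
  obtain ⟨S, hS, h⟩ := Metric.mem_closure_iff.1 hT' ε hε
  refine ⟨S, ?_, by rw [← dist_eq_norm]; exact h.le⟩
  have := adjoin_hullOp_le_span hS
  clear h hS
  induction this using Submodule.span_induction with
  | mem x hx =>
    obtain ⟨s, rfl⟩ := hx
    exact hull s
  | zero => exact zero
  | add x y _ _ hx hy => exact add x y hx hy
  | smul c x _ hx => exact smul c x hx

/-! ### Differences, right multiplication and corners -/

/-- Differences of clopen sets are clopen, hence cylinders; evaluation at the points of `P` recovers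
the underlying sets from the cylinders. -/
theorem diff_mem_Ebar {A B : Set P} (hA : A ∈ Ebar P) (hB : B ∈ Ebar P) : A \ B ∈ Ebar P := by
  obtain ⟨C, hC, h⟩ := exists_eq_cyl ((isClopen_cyl hA).diff (isClopen_cyl hB))
  have : A \ B = C := by
    ext x
    have hx : evalAt x ∈ cyl A \ cyl B ↔ evalAt x ∈ cyl C := by rw [h]
    change (evalAt x).OnBar A ∧ ¬ (evalAt x).OnBar B ↔ (evalAt x).OnBar C at hx
    rwa [evalAt_onBar hA, evalAt_onBar hB, evalAt_onBar hC] at hx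
  rwa [this]

theorem principal_mem_E (c : P) : {x | ∃ z, x = c * z} ∈ E P := by
  have : {x | ∃ z, x = c * z} = dom (leftMul c).symm := by
    ext x
    exact exists_congr fun z => by rw [PEquiv.mem_iff_mem, mem_leftMul]
  rw [this]
  exact dom_mem_E (.inv (.leftMul c))

/-- Elements of the left inverse hull commute with right multiplications. -/
theorem InHull.mul_right_mem {s : P ≃. P} (hs : InHull s) :
    ∀ {x y : P}, y ∈ s x → ∀ q, y * q ∈ s (x * q) := by
  induction hs with
  | leftMul c =>
    intro x y h q
    rw [mem_leftMul] at h ⊢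
    rw [h, mul_assoc]
  | mul _ _ ih ih' =>
    intro x z h q
    obtain ⟨y, h1, h2⟩ := mem_pmul.1 h
    exact mem_pmul.2 ⟨_, ih' h1 q, ih h2 q⟩
  | inv _ ih =>
    intro x y h q
    rw [PEquiv.mem_iff_mem] at h ⊢
    exact ih h q

theorem HullBar.exists_hull (s : HullBar P) :
    ∃ t : P ≃. P, InHull t ∧ ∀ {x y : P}, y ∈ s.1 x → y ∈ t x := by
  obtain ⟨t, A, ht, -, -, h⟩ := s.2
  refine ⟨t, ht, fun {x y} hy => ?_⟩
  rw [h] at hy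
  obtain ⟨z, hz, hzy⟩ := mem_pmul.1 hy
  obtain ⟨rfl, -⟩ := mem_partialId.1 hz
  exact hzy

theorem of_one_mem {x y : P} : y ∈ (HullBar.of (1 : P)).1 x ↔ y = x := by
  change y ∈ leftMul 1 x ↔ _
  rw [mem_leftMul, one_mul]

theorem onBar_dom_of (c : P) (χ : Omega P) : χ.OnBar (dom (HullBar.of c).1) := by
  have : dom (HullBar.of c).1 = univ := eq_univ_of_forall fun x => ⟨c * x, mem_leftMul.2 rfl⟩
  rw [this]
  exact onBar_univ χ

theorem Germ.tgt_unit (χ : Omega P) : (Germ.unit χ).tgt = χ := by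
  refine omega_ext fun e he => ?_
  refine (act_on (h := onBar_dom_of 1 χ) he).trans ?_
  have : pull (HullBar.of (1 : P)).1 e = e := by
    ext x
    constructor
    · rintro ⟨y, hy, h⟩; exact of_one_mem.1 h ▸ hy
    · exact fun h => ⟨x, h, of_one_mem.2 rfl⟩
  rw [this, χ.onBar_E he]

theorem unitSpace_eq_bis : unitSpace P = bis (HullBar.of 1) univ := by
  ext γ
  constructor
  · rintro ⟨χ, rfl⟩; exact ⟨χ, onBar_dom_of 1 χ, trivial, rfl⟩
  · rintro ⟨χ, h, -, rfl⟩; exact ⟨χ, rfl⟩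

theorem mk_eq_unit {s : HullBar P} {χ : Omega P} {h : χ.OnBar (dom s.1)}
    (hs : ∀ x y, y ∈ s.1 x → y = x) : Germ.mk s χ h = Germ.unit χ := by
  refine germ_eq.2 ⟨_, dom_mem_Ebar s.2, h, ?_⟩
  rintro x ⟨z, hz⟩ y
  rw [of_one_mem]
  obtain rfl := hs x z hz
  exact ⟨fun hy => mem_unique hy hz, fun hy => hy ▸ hz⟩

theorem eq_idem {s : HullBar P} (hs : ∀ x y, y ∈ s.1 x → y = x) :
    s = HullBar.idem (dom s.1) (dom_mem_Ebar s.2) := by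
  refine Subtype.ext (pext fun x y => ?_)
  change _ ↔ y ∈ partialId (dom s.1) x
  rw [mem_partialId]
  constructor
  · exact fun h => ⟨hs x y h, y, h⟩
  · rintro ⟨rfl, z, hz⟩
    exact hs y z hz ▸ hz

theorem hullOp_eq_zero {s : HullBar P} (hs : ∀ x y, y ∉ s.1 x) : hullOp s = 0 := by
  classical
  refine clm_ext_single fun γ β => ?_
  rw [hullOp_single, if_neg]
  · rfl
  · intro h
    obtain ⟨t, χ, ht, hd, -, -⟩ := mem_lact.1 h
    obtain ⟨x, z, hz⟩ := onBar_nonempty (dom_mem_Ebar (s.mul t).2) hd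
    obtain ⟨y, -, hy⟩ := mem_pmul.1 hz
    exact hs y z hy

/-- An equality `[s t, χ] = [t, χ]` would make `s` fix `t x` for some `x`. Hence a fixed-point-free
element has zero diagonal. -/
theorem not_mem_lact_self {s : HullBar P} (hs : ∀ x, x ∉ s.1 x) (γ : Germ P) : γ ∉ lact s γ := by
  intro h
  obtain ⟨t, χ, ht, hd, rfl, e⟩ := mem_lact.1 h
  obtain ⟨A, hA, h1, h2⟩ := germ_eq.1 e
  obtain ⟨x, hx, y, hy⟩ := onBar_nonempty (inter_mem_Ebar hA (dom_mem_Ebar t.2))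
    (χ.onBar_inter hA (dom_mem_Ebar t.2) h1 ht)
  obtain ⟨z, hz, hzy⟩ := mem_pmul.1 ((h2 x hx y).1 hy)
  obtain rfl := mem_unique hz hy
  exact hs _ hzy

theorem mem_compress {s : HullBar P} {B : Set P} {hB : B ∈ Ebar P} {x y : P} :
    y ∈ (((HullBar.idem B hB).mul s).mul (HullBar.idem B hB)).1 x ↔ x ∈ B ∧ y ∈ B ∧ y ∈ s.1 x := by
  change y ∈ pmul (pmul (partialId B) s.1) (partialId B) x ↔ _
  simp only [mem_pmul, mem_partialId]
  constructor
  · rintro ⟨_, ⟨rfl, hx⟩, _, h, rfl, hy⟩; exact ⟨hx, hy, h⟩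
  · rintro ⟨hx, hy, h⟩; exact ⟨x, ⟨rfl, hx⟩, y, h, rfl, hy⟩

end LeftCancellative

/-! ### Rigidity of the hull of ℤ ⋊ ℕ^× -/

namespace ZNat

open LeftCancellative

theorem mul_k (x y : ZNat) : (x * y).k = x.k + (x.a : ℤ) * y.k := rfl

theorem mul_a (x y : ZNat) : (x * y).a = x.a * y.a := rfl

/-- An element of the left inverse hull is the restriction of an affine map. -/
theorem affine_of_inHull {s : ZNat ≃. ZNat} (hs : InHull s) :
    ∀ {x y x' y' : ZNat}, y ∈ s x → y' ∈ s x' →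
      (y'.a : ℤ) * x.a = y.a * x'.a ∧ (y'.k - y.k) * x.a = y.a * (x'.k - x.k) := by
  induction hs with
  | leftMul c =>
    intro x y x' y' h h'
    rw [mem_leftMul] at h h'
    subst h h'
    simp only [mul_k, mul_a, PNat.mul_coe]
    push_cast
    constructor <;> ring
  | mul _ _ ih ih' =>
    intro x z x' z' h h'
    obtain ⟨y, h1, h2⟩ := mem_pmul.1 h
    obtain ⟨y', h1', h2'⟩ := mem_pmul.1 h'
    obtain ⟨e1, e2⟩ := ih' h1 h1'
    obtain ⟨e3, e4⟩ := ih h2 h2'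
    -- The relations for the composite hold after multiplication by the intermediate coordinate
    -- `y.a`, which is then cancelled.
    have hy : (y.a : ℤ) ≠ 0 := by exact_mod_cast y.a.ne_zero
    constructor
    · refine mul_left_cancel₀ hy ?_
      linear_combination (x.a : ℤ) * e3 + (z.a : ℤ) * e1
    · refine mul_left_cancel₀ hy ?_
      linear_combination (x.a : ℤ) * e4 + (z.a : ℤ) * e2
  | inv _ ih =>
    intro x y x' y' h h'
    rw [PEquiv.mem_iff_mem] at h h'
    obtain ⟨e1, e2⟩ := ih h h'
    constructor
    · linear_combination -e1
    · linear_combination -e2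

/-- One value of an affine restriction fixes its slope `y.a / x.a` and its constant term, hence
every other value. -/
theorem agree_of_agree {s t : HullBar ZNat} {x y x' y' y'' : ZNat} (hs : y ∈ s.1 x)
    (ht : y ∈ t.1 x) (hs' : y' ∈ s.1 x') (ht' : y'' ∈ t.1 x') : y' = y'' := by
  obtain ⟨s0, hs0, h1⟩ := s.exists_hull
  obtain ⟨t0, ht0, h2⟩ := t.exists_hull
  obtain ⟨e1, e2⟩ := affine_of_inHull hs0 (h1 hs) (h1 hs')
  obtain ⟨e3, e4⟩ := affine_of_inHull ht0 (h2 ht) (h2 ht')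
  have hx : (x.a : ℤ) ≠ 0 := by exact_mod_cast x.a.ne_zero
  apply ZNat.ext
  · exact mul_right_cancel₀ hx (by linarith)
  · have : (y'.a : ℤ) = y''.a := mul_right_cancel₀ hx (by linarith)
    exact_mod_cast this

/-- An element of the enlarged hull with a fixed point is idempotent. -/
theorem eq_of_fixed {s : HullBar ZNat} {x : ZNat} (hx : x ∈ s.1 x) (x' y' : ZNat)
    (h : y' ∈ s.1 x') : y' = x' :=
  agree_of_agree hx (of_one_mem.2 rfl) h (of_one_mem.2 rfl)

instance : T2Space (Germ ZNat) := by
  refine t2Space_germ fun s t x y hs ht x' hx' y' => ?_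
  obtain ⟨⟨z, hz⟩, w, hw⟩ := hx'
  obtain rfl := agree_of_agree hs ht hz hw
  exact ⟨fun h => mem_unique h hz ▸ hw, fun h => mem_unique h hw ▸ hz⟩

/-! ### Large primes and displacement -/

/-- The filter of the pairs `(k, b)` with `b` a large prime. -/
def largePrime : Filter ZNat :=
  Filter.comap (fun q : ZNat => (q.a : ℕ)) Filter.atTop ⊓
    Filter.principal {q | (q.a : ℕ).Prime}

theorem eventually_largePrime {Q : ZNat → Prop} (N : ℕ)
    (h : ∀ q : ZNat, (q.a : ℕ).Prime → N < q.a → Q q) : ∀ᶠ q in largePrime, Q q := by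
  rw [largePrime, Filter.eventually_inf_principal]
  filter_upwards [Filter.tendsto_comap.eventually (Filter.eventually_gt_atTop N)] with q hq hp
  exact h q hp hq

/-- The filter constrains only the second coordinate, so the first can be prescribed. -/
theorem exists_of_eventually {Q : ZNat → Prop} (h : ∀ᶠ q in largePrime, Q q) (k : ℤ) :
    ∃ q, q.k = k ∧ Q q := by
  rw [largePrime, Filter.eventually_inf_principal, Filter.eventually_comap,
    Filter.eventually_atTop] at h
  obtain ⟨N, hN⟩ := h
  obtain ⟨b, hb, hp⟩ := Nat.exists_infinite_primes N
  exact ⟨⟨k, ⟨b, hp.pos⟩⟩, rfl, hN b hb _ rfl hp⟩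

/-- Domains of `s` and of its inverse are treated together so that the induction passes through
inverses. The only arithmetic is in the domain `c P` of the inverse of a generator: a prime larger
than `c.a` cannot help `c.a` to divide `p.a * q.a`. -/
theorem eventually_mem_dom {s : ZNat ≃. ZNat} (hs : InHull s) :
    (∀ p, ∀ᶠ q in largePrime, p * q ∈ dom s → p ∈ dom s) ∧
      ∀ p, ∀ᶠ q in largePrime, p * q ∈ dom s.symm → p ∈ dom s.symm := by
  -- Since `t` commutes with right multiplication, `t (p q) = p' q` for `p' = t p`, and the claim
  -- for `s` at `p'` applies.
  have comp : ∀ {s t : ZNat ≃. ZNat}, InHull t →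
      (∀ p, ∀ᶠ q in largePrime, p * q ∈ dom s → p ∈ dom s) →
      (∀ p, ∀ᶠ q in largePrime, p * q ∈ dom t → p ∈ dom t) →
      ∀ p, ∀ᶠ q in largePrime, p * q ∈ dom (pmul s t) → p ∈ dom (pmul s t) := by
    intro s t ht h1 h2 p
    by_cases hp : p ∈ dom t
    · obtain ⟨p', hp'⟩ := hp
      filter_upwards [h1 p'] with q hq
      rintro ⟨z, hz⟩
      obtain ⟨y, hy, hz⟩ := mem_pmul.1 hz
      obtain rfl := mem_unique hy (ht.mul_right_mem hp' q)
      obtain ⟨w, hw⟩ := hq ⟨z, hz⟩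
      exact ⟨w, mem_pmul.2 ⟨p', hp', hw⟩⟩
    · filter_upwards [h2 p] with q hq
      rintro ⟨z, hz⟩
      obtain ⟨y, hy, hz⟩ := mem_pmul.1 hz
      exact absurd (hq ⟨y, hy⟩) hp
  induction hs with
  | leftMul c =>
    refine ⟨fun p => Filter.Eventually.of_forall fun q _ => ⟨c * p, mem_leftMul.2 rfl⟩,
      fun p => eventually_largePrime c.a fun q hq hcq => ?_⟩
    rintro ⟨y, hy⟩
    rw [PEquiv.mem_iff_mem, mem_leftMul] at hy
    have ha : (p.a : ℕ) * q.a = c.a * y.a := by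
      exact_mod_cast congrArg (fun x : ZNat => (x.a : ℕ)) hy
    have hk : p.k + (p.a : ℤ) * q.k = c.k + (c.a : ℤ) * y.k := congrArg ZNat.k hy
    have hco : Nat.Coprime c.a q.a := (Nat.coprime_of_lt_prime c.a.ne_zero hcq hq).symm
    obtain ⟨m, hm⟩ : (c.a : ℕ) ∣ p.a := hco.dvd_of_dvd_mul_right ⟨_, ha⟩
    have hm0 : 0 < m := Nat.pos_of_ne_zero fun h => p.a.ne_zero (by rw [hm, h, mul_zero])
    have hmz : (p.a : ℤ) = c.a * m := by exact_mod_cast hm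
    -- The quotient of `p` by `c`: its first coordinate solves `p.k = c.k + c.a * l`, given `p.a =
    -- c.a * m` and `hk`.
    refine ⟨⟨y.k - m * q.k, ⟨m, hm0⟩⟩, ?_⟩
    rw [PEquiv.mem_iff_mem, mem_leftMul]
    apply ZNat.ext
    · rw [mul_k]
      rw [hmz] at hk
      linear_combination hk
    · exact PNat.eq hm
  | mul hs ht ih ih' =>
    exact ⟨comp ht ih.1 ih'.1, comp (.inv hs) ih'.2 ih.2⟩
  | inv _ ih => exact ⟨ih.2, ih.1⟩

theorem eventually_mem_iff_of_E {A : Set ZNat} (hA : A ∈ E ZNat) (p : ZNat) :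
    ∀ᶠ q in largePrime, p * q ∈ A ↔ p ∈ A := by
  have hd : dom (partialId A) = A := by
    ext x
    exact ⟨fun ⟨y, hy⟩ => (mem_partialId.1 hy).2, fun h => ⟨x, mem_partialId.2 ⟨rfl, h⟩⟩⟩
  have h := (eventually_mem_dom hA).1 p
  rw [hd] at h
  filter_upwards [h] with q hq
  -- The converse holds for every `q`, because members of `E` are right ideals.
  exact ⟨hq, fun h => (mem_partialId.1 (InHull.mul_right_mem hA (mem_partialId.2 ⟨rfl, h⟩) q)).2⟩

theorem eventually_mem_iff {A : Set ZNat} (hA : A ∈ Ebar ZNat) (p : ZNat) :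
    ∀ᶠ q in largePrime, p * q ∈ A ↔ p ∈ A := by
  obtain ⟨S, hS, rfl⟩ := hA
  filter_upwards [(Filter.eventually_all_finite hS.supp.1).2 fun e he =>
    eventually_mem_iff_of_E (hS.supp.2 he) p] with q hq
  rw [mem_repSet, mem_repSet]
  refine exists_congr fun r => and_congr_right fun hr => ?_
  refine and_congr (hq _ (mem_biUnion hr (mem_insert _ _))) (forall₂_congr fun f hf => ?_)
  rw [hq _ (mem_biUnion hr (mem_insert_of_mem _ hf))]

/-- All elements of `p q P` have first coordinate congruent to `p.k + p.a * k` modulo `q.a`, and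
likewise for `p'`. Once `q.a` exceeds the nonzero difference of these two numbers, the classes are
distinct. -/
theorem exists_mul_disjoint {p p' : ZNat} (h : p ≠ p') :
    ∃ k : ℤ, ∀ᶠ q in largePrime, q.k = k → ∀ z w, p' * q * z ≠ p * q * w := by
  -- Two affine functions of `k` that agree at 0 and 1 have the same coefficients.
  obtain ⟨k, hk⟩ : ∃ k : ℤ, p'.k + p'.a * k - (p.k + p.a * k) ≠ 0 := by
    by_contra hc
    push Not at hc
    have h0 := hc 0
    have h1 := hc 1
    refine h (ZNat.ext (by linarith) ?_)
    have : (p.a : ℤ) = p'.a := by linarith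
    exact_mod_cast this
  refine ⟨k, eventually_largePrime (p'.k + p'.a * k - (p.k + p.a * k)).natAbs
    fun q _ hN hqk z w e => ?_⟩
  have hkk : p'.k + (p'.a : ℤ) * q.k + ((p'.a * q.a : ℕ+) : ℤ) * z.k =
    p.k + (p.a : ℤ) * q.k + ((p.a * q.a : ℕ+) : ℤ) * w.k := congrArg ZNat.k e
  push_cast at hkk
  rw [hqk] at hkk
  have hdvd : ((q.a : ℕ) : ℤ) ∣ p'.k + p'.a * k - (p.k + p.a * k) :=
    ⟨p.a * w.k - p'.a * z.k, by linear_combination hkk⟩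
  exact absurd (Nat.le_of_dvd (Int.natAbs_pos.2 hk) (Int.natCast_dvd.1 hdvd)) (by omega)

/-- Below every point that an element of the enlarged hull moves there is a set that it moves off
itself. -/
theorem exists_moved_off {s : HullBar ZNat} {A : Set ZNat} (hA : A ∈ Ebar ZNat) {p p' : ZNat}
    (hp : p ∈ A) (hs : p' ∈ s.1 p) (hne : p ≠ p') :
    ∃ B ∈ Ebar ZNat, B ⊆ A ∧ B.Nonempty ∧ ∀ x ∈ B, ∀ y ∈ s.1 x, y ∉ B := by
  obtain ⟨k, hk⟩ := exists_mul_disjoint hne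
  obtain ⟨q, hqk, hqA, hq⟩ := exists_of_eventually ((eventually_mem_iff hA p).and hk) k
  -- The part of the right ideal of `p q` inside `A`; it contains `p q`, and `s` sends `p q z` to
  -- `p' q z` wherever it is defined.
  refine ⟨A ∩ {x | ∃ z, x = p * q * z}, inter_mem_Ebar hA (E_subset_Ebar (principal_mem_E _)),
    inter_subset_left, ⟨p * q, hqA.2 hp, 1, (mul_one _).symm⟩, ?_⟩
  rintro _ ⟨-, z, rfl⟩ y hy ⟨-, w, rfl⟩
  obtain ⟨t, ht, aux⟩ := s.exists_hull
  exact hq hqk z w (mem_unique (ht.mul_right_mem (ht.mul_right_mem (aux hs) q) z) (aux hy))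

/-! ### The isotropy -/

/-- Around an interior isotropy germ of `s` all germs of `s` over some cylinder of `A` are isotropy.
A fixed point in `A` makes `s` idempotent and the germ a unit. A moved point gives a set `B` moved
off itself, and evaluation at a point of `B` contradicts isotropy. -/
theorem interior_iso : interior (Iso ZNat) = unitSpace ZNat := by
  refine Subset.antisymm ?_ (interior_maximal ?_ ?_)
  · intro γ hγ
    obtain ⟨s, χ, hχ, rfl⟩ := γ.exists_rep
    obtain ⟨U, hU, hUs⟩ := isOpen_induced_iff.1 (isOpen_interior.preimage (continuous_germ s))
    have hmem : ∀ ψ (hψ : ψ.OnBar (dom s.1)), ψ ∈ U ↔ Germ.mk s ψ hψ ∈ interior (Iso ZNat) :=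
      fun ψ hψ => Set.ext_iff.1 hUs ⟨ψ, hψ⟩
    obtain ⟨A, hA, hχA, hAU⟩ := exists_cyl_subset hU ((hmem χ hχ).2 hγ)
    obtain ⟨p, hpA, p', hp'⟩ := onBar_nonempty (inter_mem_Ebar hA (dom_mem_Ebar s.2))
      (χ.onBar_inter hA (dom_mem_Ebar s.2) hχA hχ)
    by_cases hpp : p = p'
    · subst hpp
      exact ⟨χ, (mk_eq_unit (eq_of_fixed hp')).symm⟩
    · obtain ⟨B, hB, hBA, ⟨x, hx⟩, hBs⟩ := exists_moved_off
        (inter_mem_Ebar hA (dom_mem_Ebar s.2)) ⟨hpA, p', hp'⟩ hp' hpp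
      have hxs : (evalAt x).OnBar (dom s.1) := (evalAt_onBar (dom_mem_Ebar s.2)).2 (hBA hx).2
      have hiso := interior_subset ((hmem _ hxs).1 (hAU ((evalAt_onBar hA).2 (hBA hx).1)))
      have hact : act s (evalAt x) hxs = evalAt x := Eq.symm hiso
      have h1 : (act s (evalAt x) hxs).OnBar B := by rw [hact]; exact (evalAt_onBar hB).2 hx
      -- Evaluated on `B`, the invariance of the character says that `s x` lies in `B`.
      rw [act_onBar hB, evalAt_onBar (pull_mem_Ebar s.2 hB)] at h1
      obtain ⟨y, hy, hxy⟩ := h1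
      exact absurd hy (hBs x hx y hxy)
  · rintro _ ⟨χ, rfl⟩
    exact (Germ.tgt_unit χ).symm
  · rw [unitSpace_eq_bis]
    exact isOpen_bis _ isOpen_univ

/-- The generator of the group of invertible elements. -/
def translation : ZNat := ⟨1, 1⟩

theorem isUnit_translation : IsUnit translation :=
  ⟨⟨translation, ⟨-1, 1⟩, rfl, rfl⟩, rfl⟩

theorem translation_mul_ne (x : ZNat) : translation * x ≠ x := by
  intro h
  have : (1 : ℤ) + ((1 : ℕ+) : ℤ) * x.k = x.k := congrArg ZNat.k h
  simp at this

theorem of_translation_not_mem (x : ZNat) : x ∉ (HullBar.of translation).1 x := fun h =>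
  translation_mul_ne x (mem_leftMul.1 h).symm

theorem bis_translation_subset : bis (HullBar.of translation) univ ⊆ unitsAction ZNat := by
  rintro _ ⟨χ, h, -, rfl⟩
  exact ⟨_, χ, h, isUnit_translation, rfl⟩

theorem unitSpace_subset_unitsAction : unitSpace ZNat ⊆ unitsAction ZNat := by
  rintro _ ⟨χ, rfl⟩
  exact ⟨1, χ, onBar_dom_of 1 χ, isUnit_one, rfl⟩

theorem unitSpace_ssubset_unitsAction : unitSpace ZNat ⊂ unitsAction ZNat := by
  refine ⟨unitSpace_subset_unitsAction, fun h => ?_⟩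
  obtain ⟨χ, e⟩ := h (bis_translation_subset
    ⟨evalAt 1, onBar_dom_of _ _, trivial, rfl⟩)
  obtain rfl : χ = evalAt 1 := congrArg Germ.src e
  obtain ⟨A, hA, h1, h2⟩ := germ_eq.1 e
  obtain ⟨x, hx⟩ := onBar_nonempty hA h1
  exact of_translation_not_mem x ((h2 x hx x).1 (of_one_mem.2 rfl))

end ZNat

namespace LeftCancellative

universe u

/-! ### Inclusions of reduced C*-algebras -/

variable {P : Type u} [Monoid P] [IsLeftCancelMul P]

theorem reducedCStar_mono {H K : Set (Germ P)} (h : H ⊆ K) : reducedCStar H ≤ reducedCStar K :=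
  NonUnitalStarSubalgebra.topologicalClosure_mono (NonUnitalStarAlgebra.adjoin_mono
    fun _ ⟨f, h1, h2, h3, h4⟩ => ⟨f, h1, h2, h3.trans h, h4⟩)

/-- `γ β⁻¹` being a unit means that `γ` is the image of `β` under the left action of 1, which is an
idempotent. -/
theorem eq_of_mul_inv_mem_unitSpace {β γ : Germ P} (h : γ.src = β.src)
    (h' : γ.mul β.inv (h.trans β.tgt_inv.symm) ∈ unitSpace P) : γ = β := by
  rw [unitSpace_eq_bis] at h'
  have hl : γ ∈ lact (HullBar.of 1) β := mem_lact_iff.2 ⟨h, h'⟩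
  rw [eq_idem (s := HullBar.of (1 : P)) fun x y => of_one_mem.1] at hl
  exact (mem_lact_idem.1 hl).1

open Classical in
/-- The operators in the reduced C*-algebra of the unit space are diagonal. -/
theorem diagonal_of_mem_reducedCStar_unitSpace {T : L2 P →L[ℂ] L2 P}
    (hT : T ∈ reducedCStar (unitSpace P)) :
    ∀ γ β, γ ≠ β → (T (lp.single 2 β (1 : ℂ)) : L2 P) γ = 0 := by
  have hT' : T ∈ closure (NonUnitalStarAlgebra.adjoin ℂ {T | ∃ f : Germ P → ℂ, Continuous f ∧
      HasCompactSupport f ∧ tsupport f ⊆ unitSpace P ∧ IsConvolution f T} : Set _) := hT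
  intro γ β hne
  -- A matrix entry is bounded by the operator norm, so its vanishing passes to norm limits.
  have hcl : IsClosed {T : L2 P →L[ℂ] L2 P | (T (lp.single 2 β (1 : ℂ)) : L2 P) γ = 0} := by
    refine isClosed_iff_clusterPt.2 fun T hT => ?_
    rw [← mem_closure_iff_clusterPt, Metric.mem_closure_iff] at hT
    refine norm_le_zero_iff.1 (le_of_forall_pos_le_add fun ε hε => ?_)
    obtain ⟨S, hS, hd⟩ := hT ε hε
    have h1 := norm_matrix_le (T - S) γ β
    rw [sub_apply, lp.coeFn_sub, Pi.sub_apply, (show _ = (0 : ℂ) from hS), sub_zero] at h1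
    rw [dist_eq_norm] at hd
    linarith
  refine closure_minimal ?_ hcl hT'
  intro T hT
  -- All off-diagonal entries are carried through the induction at once: for a product, the whole
  -- column of the right factor has to be known.
  have key : ∀ γ β, γ ≠ β → (T (lp.single 2 β (1 : ℂ)) : L2 P) γ = 0 := by
    induction hT using NonUnitalStarAlgebra.adjoin_induction with
    | mem x hx =>
      obtain ⟨f, -, -, h1, h2⟩ := hx
      intro γ β hne
      rw [h2]
      split_ifs with h
      · exact image_eq_zero_of_notMem_tsupport
          fun h' => hne (eq_of_mul_inv_mem_unitSpace h (h1 h'))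
      · rfl
    | add x y _ _ hx hy =>
      intro γ β hne
      rw [add_apply, lp.coeFn_add, Pi.add_apply, hx γ β hne, hy γ β hne, add_zero]
    | zero => exact fun _ _ _ => rfl
    | mul x y _ _ hx hy =>
      intro γ β hne
      have : y (lp.single 2 β (1 : ℂ)) =
          (y (lp.single 2 β (1 : ℂ)) : L2 P) β • lp.single 2 β (1 : ℂ) := by
        refine lp.ext (funext fun α => ?_)
        rw [lp.coeFn_smul, Pi.smul_apply, lp.single_apply, smul_eq_mul]
        by_cases h : α = β
        · rw [h, Pi.single_eq_same, mul_one]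
        · rw [Pi.single_eq_of_ne h, mul_zero, hy α β h]
      rw [mul_apply_eq_comp, this, map_smul, lp.coeFn_smul, Pi.smul_apply, hx γ β hne, smul_zero]
    | smul c x _ hx =>
      intro γ β hne
      rw [smul_apply, lp.coeFn_smul, Pi.smul_apply, hx γ β hne, smul_zero]
    | star x _ hx =>
      intro γ β hne
      rw [star_matrix, hx β γ hne.symm, star_zero]
  exact key γ β hne

end LeftCancellative

namespace ZNat

open LeftCancellative

/-- The translation operator has an entry 1 off the diagonal, which no element of the smaller
algebra has. -/
theorem reducedCStar_unitSpace_lt :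
    reducedCStar (unitSpace ZNat) < reducedCStar (unitsAction ZNat) := by
  classical
  refine lt_of_le_of_ne (reducedCStar_mono unitSpace_subset_unitsAction) fun e => ?_
  have h := hullOp_mem_reducedCStar bis_translation_subset
  rw [← e] at h
  set β := Germ.unit (evalAt (1 : ZNat)) with hβ
  obtain ⟨γ, hγ⟩ : ∃ γ, γ ∈ lact (HullBar.of translation) β :=
    ⟨_, mem_lact.2 ⟨_, _, onBar_dom_of 1 _, by
      refine onBar_dom_mul (onBar_dom_of 1 _) ?_
      exact onBar_dom_of _ _, rfl, rfl⟩⟩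
  have hne : γ ≠ β := by
    rintro rfl
    exact not_mem_lact_self of_translation_not_mem _ hγ
  have := diagonal_of_mem_reducedCStar_unitSpace h γ β hne
  rw [hullOp_single, if_pos hγ] at this
  exact one_ne_zero this

/-! ### Detection of ideals -/

open Classical in
/-- The diagonal matrix entries depend continuously on the target. -/
theorem exists_diagonal_close {T : L2 ZNat →L[ℂ] L2 ZNat} {H : Set (Germ ZNat)}
    (hT : T ∈ reducedCStar H) (γ : Germ ZNat) {ε : ℝ} (hε : 0 < ε) :
    ∃ A ∈ Ebar ZNat, γ.tgt.OnBar A ∧ ∀ β : Germ ZNat, β.tgt.OnBar A →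
      ‖(T (lp.single 2 β (1 : ℂ)) : L2 ZNat) β - (T (lp.single 2 γ (1 : ℂ)) : L2 ZNat) γ‖ ≤ ε := by
  refine reducedCStar_induction (p := fun T => ∀ γ : Germ ZNat, ∀ ε > 0, ∃ A ∈ Ebar ZNat,
    γ.tgt.OnBar A ∧ ∀ β : Germ ZNat, β.tgt.OnBar A →
      ‖(T (lp.single 2 β (1 : ℂ)) : L2 ZNat) β - (T (lp.single 2 γ (1 : ℂ)) : L2 ZNat) γ‖ ≤ ε)
    ?_ ?_ ?_ ?_ ?_ hT γ ε hε
  · intro s γ ε hε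
    -- With a fixed point, `s` is idempotent and its diagonal is the indicator of a clopen set of
    -- targets, hence locally constant. Without one, the diagonal vanishes.
    by_cases hs : ∃ x, x ∈ s.1 x
    · obtain ⟨x, hx⟩ := hs
      have hlact : ∀ β : Germ ZNat, β ∈ lact s β ↔ β.tgt.OnBar (dom s.1) := by
        intro β
        rw [eq_idem (eq_of_fixed hx), mem_lact_idem, ← eq_idem (eq_of_fixed hx)]
        simp
      by_cases h : γ.tgt.OnBar (dom s.1)
      · refine ⟨_, dom_mem_Ebar s.2, h, fun β hβ => ?_⟩
        rw [hullOp_single, hullOp_single, if_pos ((hlact β).2 hβ), if_pos ((hlact γ).2 h), sub_self,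
          norm_zero]
        exact hε.le
      · obtain ⟨A, hA, hγA, hAs⟩ := exists_cyl_subset
          (isClopen_cyl (dom_mem_Ebar s.2)).compl.isOpen (show γ.tgt ∈ (cyl (dom s.1))ᶜ from h)
        refine ⟨A, hA, hγA, fun β hβ => ?_⟩
        rw [hullOp_single, hullOp_single, if_neg (fun h => hAs hβ ((hlact β).1 h)),
          if_neg (fun h' => h ((hlact γ).1 h')), sub_self, norm_zero]
        exact hε.le
    · push Not at hs
      refine ⟨univ, E_subset_Ebar univ_mem_E, onBar_univ _, fun β _ => ?_⟩
      rw [hullOp_single, hullOp_single, if_neg (not_mem_lact_self hs β),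
        if_neg (not_mem_lact_self hs γ), sub_self, norm_zero]
      exact hε.le
  · intro γ ε hε
    refine ⟨univ, E_subset_Ebar univ_mem_E, onBar_univ _, fun β _ => ?_⟩
    refine le_trans (le_of_eq ?_) hε.le
    exact (congrArg norm (sub_self (0 : ℂ))).trans norm_zero
  · intro S T hS hT γ ε hε
    obtain ⟨A, hA, hγA, h1⟩ := hS γ (ε / 2) (by positivity)
    obtain ⟨B, hB, hγB, h2⟩ := hT γ (ε / 2) (by positivity)
    have hAB := inter_mem_Ebar hA hB
    refine ⟨_, hAB, γ.tgt.onBar_inter hA hB hγA hγB, fun β hβ => ?_⟩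
    rw [add_apply, add_apply, lp.coeFn_add, lp.coeFn_add, Pi.add_apply, Pi.add_apply,
      add_sub_add_comm]
    refine (norm_add_le _ _).trans ?_
    linarith [h1 β (onBar_mono hAB hA inter_subset_left hβ),
      h2 β (onBar_mono hAB hB inter_subset_right hβ)]
  · intro c T hT γ ε hε
    -- The added 1 keeps the denominator positive when `c = 0`.
    obtain ⟨A, hA, hγA, h1⟩ := hT γ (ε / (‖c‖ + 1)) (by positivity)
    refine ⟨A, hA, hγA, fun β hβ => ?_⟩
    rw [smul_apply, smul_apply, lp.coeFn_smul, lp.coeFn_smul, Pi.smul_apply, Pi.smul_apply,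
      ← smul_sub, norm_smul]
    have hc : 0 < ‖c‖ + 1 := by positivity
    calc ‖c‖ * _ ≤ (‖c‖ + 1) * (ε / (‖c‖ + 1)) :=
          mul_le_mul (by linarith) (h1 β hβ) (norm_nonneg _) hc.le
      _ = ε := by field_simp
  · intro T hT γ ε hε
    obtain ⟨S, hS, hTS⟩ := hT (ε / 3) (by positivity)
    obtain ⟨A, hA, hγA, h1⟩ := hS γ (ε / 3) (by positivity)
    refine ⟨A, hA, hγA, fun β hβ => ?_⟩
    have e1 := (norm_matrix_le (T - S) β β).trans hTS
    have e2 := (norm_matrix_le (T - S) γ γ).trans hTS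
    have e3 := h1 β hβ
    rw [sub_apply, lp.coeFn_sub, Pi.sub_apply] at e1 e2
    set a := (T (lp.single 2 β (1 : ℂ)) : L2 ZNat) β
    set b := (T (lp.single 2 γ (1 : ℂ)) : L2 ZNat) γ
    set c := (S (lp.single 2 β (1 : ℂ)) : L2 ZNat) β
    set d := (S (lp.single 2 γ (1 : ℂ)) : L2 ZNat) γ
    have : a - b = (a - c) + (c - d) - (b - d) := by ring
    rw [this]
    refine (norm_sub_le _ _).trans ?_
    linarith [norm_add_le (a - c) (c - d)]

end ZNat

/-! ### Compression to corners and idempotents in closed ideals -/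

namespace LeftCancellative

universe u

variable {P : Type u} [Monoid P] [IsLeftCancelMul P]

theorem idem_mul_idem {B C : Set P} {hB : B ∈ Ebar P} {hC : C ∈ Ebar P} (h : C ⊆ B) :
    hullOp (HullBar.idem B hB) * hullOp (HullBar.idem C hC) = hullOp (HullBar.idem C hC) ∧
      hullOp (HullBar.idem C hC) * hullOp (HullBar.idem B hB) = hullOp (HullBar.idem C hC) := by
  rw [hullOp_mul, hullOp_mul]
  constructor
  · congr 1
    refine Subtype.ext (pext fun x y => ?_)
    change y ∈ pmul (partialId B) (partialId C) x ↔ y ∈ partialId C x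
    simp only [mem_pmul, mem_partialId]
    constructor
    · rintro ⟨_, ⟨rfl, hx⟩, rfl, _⟩; exact ⟨rfl, hx⟩
    · rintro ⟨rfl, hx⟩; exact ⟨y, ⟨rfl, hx⟩, rfl, h hx⟩
  · congr 1
    refine Subtype.ext (pext fun x y => ?_)
    change y ∈ pmul (partialId C) (partialId B) x ↔ y ∈ partialId C x
    simp only [mem_pmul, mem_partialId]
    constructor
    · rintro ⟨_, ⟨rfl, _⟩, rfl, hx⟩; exact ⟨rfl, hx⟩
    · rintro ⟨rfl, hx⟩; exact ⟨y, ⟨rfl, h hx⟩, rfl, hx⟩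

/-- For projections `q ≤ p` one has `q T q - c q = q (p T p - c p) q`. So an approximation by a
scalar survives shrinking the corner, and successive approximations can be combined. -/
theorem norm_compress_le {B C : Set P} (hB : B ∈ Ebar P) (hC : C ∈ Ebar P) (h : C ⊆ B)
    (T : L2 P →L[ℂ] L2 P) (c : ℂ) :
    ‖hullOp (HullBar.idem C hC) * T * hullOp (HullBar.idem C hC) -
        c • hullOp (HullBar.idem C hC)‖ ≤
      ‖hullOp (HullBar.idem B hB) * T * hullOp (HullBar.idem B hB) -
        c • hullOp (HullBar.idem B hB)‖ := by
  obtain ⟨e1, e2⟩ := idem_mul_idem (hB := hB) (hC := hC) h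
  have e3 := (idem_mul_idem (hB := hC) (hC := hC) Subset.rfl).1
  have hn : ‖hullOp (HullBar.idem C hC)‖ ≤ 1 := norm_shift_le _
  set p := hullOp (HullBar.idem B hB)
  set q := hullOp (HullBar.idem C hC)
  have : q * T * q - c • q = q * (p * T * p - c • p) * q := by
    calc q * T * q - c • q = (q * p) * T * (p * q) - c • ((q * p) * q) := by rw [e1, e2, e3]
      _ = _ := by rw [mul_sub, sub_mul, mul_smul_comm, smul_mul_assoc]; simp only [mul_assoc]
  rw [this]
  calc _ ≤ ‖q‖ * ‖p * T * p - c • p‖ * ‖q‖ := (norm_mul_le _ _).trans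
        (mul_le_mul_of_nonneg_right (norm_mul_le _ _) (norm_nonneg _))
    _ ≤ 1 * ‖p * T * p - c • p‖ * 1 := by gcongr
    _ = _ := by ring

open Classical in
theorem idem_single {B : Set P} {hB : B ∈ Ebar P} {β : Germ P} (h : β.tgt.OnBar B) :
    hullOp (HullBar.idem B hB) (lp.single 2 β (1 : ℂ)) = lp.single 2 β (1 : ℂ) := by
  refine lp.ext (funext fun γ => ?_)
  rw [hullOp_idem_apply, lp.single_apply]
  by_cases hγ : γ = β
  · rw [hγ, if_pos h]
  · rw [Pi.single_eq_of_ne hγ]; exact ite_self 0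

open Classical in
theorem compress_entry {B : Set P} {hB : B ∈ Ebar P} {β : Germ P} (h : β.tgt.OnBar B)
    (T : L2 P →L[ℂ] L2 P) (c : ℂ) :
    ((hullOp (HullBar.idem B hB) * T * hullOp (HullBar.idem B hB) -
      c • hullOp (HullBar.idem B hB)) (lp.single 2 β (1 : ℂ)) : L2 P) β =
        (T (lp.single 2 β (1 : ℂ)) : L2 P) β - c := by
  rw [sub_apply, lp.coeFn_sub, Pi.sub_apply, mul_apply_eq_comp, mul_apply_eq_comp, idem_single h,
    hullOp_idem_apply, if_pos h, smul_apply, idem_single h, lp.coeFn_smul, Pi.smul_apply,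
    lp.single_apply, Pi.single_eq_same, smul_eq_mul, mul_one]

open Classical in
theorem star_mul_self_entry (T : L2 P →L[ℂ] L2 P) (β : Germ P) :
    ((star T * T) (lp.single 2 β (1 : ℂ)) : L2 P) β =
      ((‖T (lp.single 2 β (1 : ℂ))‖ ^ 2 : ℝ) : ℂ) := by
  have h := ContinuousLinearMap.adjoint_inner_right T (lp.single 2 β (1 : ℂ))
    (T (lp.single 2 β (1 : ℂ)))
  rw [lp.inner_single_left, inner_self_eq_norm_sq_to_K] at h
  rw [mul_apply_eq_comp, ContinuousLinearMap.star_eq_adjoint]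
  simpa using h

end LeftCancellative

/-- In a closed ideal, an element at distance less than one from an idempotent `e`, on which `e`
acts as the identity from the left, forces `e` to be in the ideal. -/
theorem TwoSidedIdeal.idempotent_mem_of_norm_sub_lt {R : Type*} [NormedRing R] [StarRing R]
    [Module ℂ R] {A : NonUnitalStarSubalgebra ℂ R} (J : TwoSidedIdeal A)
    (hJ : IsClosed {x : A | x ∈ J}) {e y : A} (he : e * e = e) (hy : y ∈ J) (hey : e * y = y)
    (h : ‖(e - y : R)‖ < 1) : e ∈ J := by
  set z : A := e - y with hz
  have hez : e * z = z := by rw [hz, mul_sub, he, hey]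
  -- `w n` is the power `z ^ (n + 1)`; the algebra has no unit, so the recursion starts at `z`.
  let w : ℕ → A := fun n => Nat.rec z (fun _ v => v * z) n
  have hw : ∀ n, e - w n ∈ J := by
    intro n
    induction n with
    | zero =>
      change e - z ∈ J
      rw [hz, sub_sub_cancel]
      exact hy
    | succ n ih =>
      -- Since `e z = z`, this telescopes modulo the ideal: `e - z = y` lies in `J`, and so does the
      -- first summand by induction. As the powers of `z` tend to 0, closedness gives `e ∈ J`.
      have : e - w (n + 1) = (e - w n) * z + (e - z) := by
        change e - w n * z = _
        rw [sub_mul, hez]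
        abel
      rw [this]
      refine J.add_mem (J.mul_mem_right _ _ ih) ?_
      rw [hz, sub_sub_cancel]
      exact hy
  have hn : ∀ n, ‖(w n).1‖ ≤ ‖(z : R)‖ ^ (n + 1) := by
    intro n
    induction n with
    | zero =>
      rw [zero_add, pow_one]
      exact le_refl ‖z.1‖
    | succ n ih =>
      rw [pow_succ]
      exact (norm_mul_le (w n).1 z.1).trans (mul_le_mul_of_nonneg_right ih (norm_nonneg _))
  have hlim : Filter.Tendsto (fun n => e - w n) Filter.atTop (𝓝 e) := by
    rw [tendsto_subtype_rng]
    have h0 : Filter.Tendsto (fun n => (w n).1) Filter.atTop (𝓝 0) := by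
      refine squeeze_zero_norm hn ?_
      exact (tendsto_pow_atTop_nhds_zero_of_lt_one (norm_nonneg _) h).comp
        (Filter.tendsto_add_atTop_nat 1)
    have := (tendsto_const_nhds (x := (e : R))).sub h0
    rwa [sub_zero] at this
  exact hJ.mem_of_tendsto hlim (Filter.Eventually.of_forall hw)

/-- A closed ideal contains an idempotent `e` as soon as it contains an element whose compression
to the corner of `e` is close to a nonzero multiple of `e`. -/
theorem TwoSidedIdeal.idempotent_mem_of_compress {R : Type*} [NormedRing R] [NormedAlgebra ℂ R]
    [StarRing R] {A : NonUnitalStarSubalgebra ℂ R} (J : TwoSidedIdeal A)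
    (hJ : IsClosed {x : A | x ∈ J}) {e a : A} (he : e * e = e) (ha : a ∈ J) {c : ℂ}
    (h : ‖(e * a * e - c • e : R)‖ < ‖c‖) : e ∈ J := by
  have hc : 0 < ‖c‖ := (norm_nonneg _).trans_lt h
  -- Dividing the compression by `c` brings it within distance less than 1 of `e`.
  refine J.idempotent_mem_of_norm_sub_lt hJ (y := (c⁻¹ • e) * a * e) he
    (J.mul_mem_right _ _ (J.mul_mem_left _ _ ha)) ?_ ?_
  · rw [← mul_assoc, ← mul_assoc, mul_smul_comm, he]
  · have : (e - ((c⁻¹ • e) * a * e : A) : R) = -(c⁻¹ • (e * a * e - c • e : R)) := by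
      rw [smul_sub, smul_smul, inv_mul_cancel₀ (norm_pos_iff.1 hc), one_smul, neg_sub,
        ← smul_mul_assoc, ← smul_mul_assoc]
      rfl
    rw [this, norm_neg, norm_smul, norm_inv, inv_mul_lt_iff₀ hc, mul_one]
    exact h

/-! ### Ideal detection by the unit space -/

namespace ZNat

open LeftCancellative

/-- An element of the reduced C*-algebra is close to a scalar on small corners. -/
theorem exists_compress_close {T : L2 ZNat →L[ℂ] L2 ZNat} {H : Set (Germ ZNat)}
    (hT : T ∈ reducedCStar H) {ε : ℝ} (hε : 0 < ε) {A : Set ZNat} (hA : A ∈ Ebar ZNat)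
    (hne : A.Nonempty) : ∃ (B : Set ZNat) (hB : B ∈ Ebar ZNat) (c : ℂ), B ⊆ A ∧ B.Nonempty ∧
      ‖hullOp (HullBar.idem B hB) * T * hullOp (HullBar.idem B hB) -
        c • hullOp (HullBar.idem B hB)‖ ≤ ε := by
  refine reducedCStar_induction (p := fun T => ∀ ε > 0, ∀ A ∈ Ebar ZNat, A.Nonempty →
    ∃ (B : Set ZNat) (hB : B ∈ Ebar ZNat) (c : ℂ), B ⊆ A ∧ B.Nonempty ∧
      ‖hullOp (HullBar.idem B hB) * T * hullOp (HullBar.idem B hB) -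
        c • hullOp (HullBar.idem B hB)‖ ≤ ε) ?_ ?_ ?_ ?_ ?_ hT ε hε A hA hne
  · rintro s ε hε A hA ⟨p, hp⟩
    have off : ∀ (B : Set ZNat) (hB : B ∈ Ebar ZNat), (∀ x ∈ B, ∀ y ∈ s.1 x, y ∉ B) →
        ‖hullOp (HullBar.idem B hB) * hullOp s * hullOp (HullBar.idem B hB) -
          (0 : ℂ) • hullOp (HullBar.idem B hB)‖ ≤ ε := by
      intro B hB h
      rw [hullOp_mul, hullOp_mul, hullOp_eq_zero, zero_smul, sub_zero, norm_zero]
      · exact hε.le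
      · intro x y hxy
        obtain ⟨hx, hy, hs⟩ := mem_compress.1 hxy
        exact h x hx y hs hy
    -- If `s` fixes `p`, it is idempotent and the scalar is 1 on `A ∩ dom s`. If it moves `p`, the
    -- scalar is 0 on a set moved off itself. If it is undefined at `p`, the scalar is 0 on `A \ dom
    -- s`.
    by_cases hps : p ∈ dom s.1
    · obtain ⟨p', hp'⟩ := hps
      by_cases hpp : p = p'
      · subst hpp
        have hB := inter_mem_Ebar hA (dom_mem_Ebar s.2)
        refine ⟨_, hB, 1, inter_subset_left, ⟨p, hp, p, hp'⟩, ?_⟩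
        have : ((HullBar.idem _ hB).mul s).mul (HullBar.idem _ hB) = HullBar.idem _ hB := by
          refine Subtype.ext (pext fun x y => mem_compress.trans ?_)
          change _ ↔ y ∈ partialId (A ∩ dom s.1) x
          rw [mem_partialId]
          constructor
          · rintro ⟨h1, -, h2⟩; exact ⟨eq_of_fixed hp' x y h2, h1⟩
          · rintro ⟨rfl, h1, z, hz⟩
            exact ⟨⟨h1, z, hz⟩, ⟨h1, z, hz⟩, eq_of_fixed hp' y z hz ▸ hz⟩
        rw [hullOp_mul, hullOp_mul, this, one_smul, sub_self, norm_zero]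
        exact hε.le
      · obtain ⟨B, hB, hBA, hBne, h⟩ := exists_moved_off hA hp hp' hpp
        exact ⟨B, hB, 0, hBA, hBne, off B hB h⟩
    · refine ⟨_, diff_mem_Ebar hA (dom_mem_Ebar s.2), 0, fun x hx => hx.1, ⟨p, hp, hps⟩, off _ _ ?_⟩
      exact fun x hx y hy => absurd ⟨y, hy⟩ hx.2
  · intro ε hε A hA hne
    refine ⟨A, hA, 0, Subset.rfl, hne, ?_⟩
    rw [mul_zero, zero_mul, zero_smul, sub_zero, norm_zero]
    exact hε.le
  · intro S T hS hT ε hε A hA hne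
    obtain ⟨B, hB, c, hBA, hBne, h1⟩ := hS (ε / 2) (by positivity) A hA hne
    -- The corner for `T` is sought inside the one found for `S`, so that both estimates hold on it.
    obtain ⟨C, hC, d, hCB, hCne, h2⟩ := hT (ε / 2) (by positivity) B hB hBne
    refine ⟨C, hC, c + d, hCB.trans hBA, hCne, ?_⟩
    rw [mul_add, add_mul, add_smul, add_sub_add_comm]
    refine (norm_add_le _ _).trans ?_
    linarith [norm_compress_le hB hC hCB S c]
  · intro a T hT ε hε A hA hne
    obtain ⟨B, hB, c, hBA, hBne, h⟩ := hT (ε / (‖a‖ + 1)) (by positivity) A hA hne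
    refine ⟨B, hB, a * c, hBA, hBne, ?_⟩
    rw [mul_smul_comm, smul_mul_assoc, mul_smul, ← smul_sub, norm_smul]
    have ha : 0 < ‖a‖ + 1 := by positivity
    calc ‖a‖ * _ ≤ (‖a‖ + 1) * (ε / (‖a‖ + 1)) :=
          mul_le_mul (by linarith) h (norm_nonneg _) ha.le
      _ = ε := by field_simp
  · intro T hT ε hε A hA hne
    obtain ⟨S, hS, hTS⟩ := hT (ε / 2) (by positivity)
    obtain ⟨B, hB, c, hBA, hBne, h⟩ := hS (ε / 2) (by positivity) A hA hne
    refine ⟨B, hB, c, hBA, hBne, ?_⟩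
    have hn : ‖hullOp (HullBar.idem B hB)‖ ≤ 1 := norm_shift_le _
    set p := hullOp (HullBar.idem B hB)
    have e : p * T * p - c • p = p * (T - S) * p + (p * S * p - c • p) := by
      rw [mul_sub, sub_mul]
      abel
    rw [e]
    have h3 : ‖p * (T - S) * p‖ ≤ ε / 2 := by
      calc _ ≤ ‖p‖ * ‖T - S‖ * ‖p‖ := (norm_mul_le _ _).trans
            (mul_le_mul_of_nonneg_right (norm_mul_le _ _) (norm_nonneg _))
        _ ≤ 1 * ‖T - S‖ * 1 := by gcongr
        _ ≤ ε / 2 := by linarith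
    exact (norm_add_le _ _).trans (by linarith)

theorem bis_idem_subset {B : Set ZNat} (hB : B ∈ Ebar ZNat) :
    bis (HullBar.idem B hB) univ ⊆ unitSpace ZNat := by
  rintro _ ⟨χ, h, -, rfl⟩
  exact ⟨χ, (mk_eq_unit fun x y hy => (mem_partialId.1 hy).1).symm⟩

/-- A nonzero closed ideal is shown to contain the projection of some nonempty `B`: the diagonal
entries of `x* x` over a small set of targets are bounded away from 0, which forces the scalar `c`
of a corner there to be nonzero. -/
theorem detectsIdeals_unitSpace :
    DetectsIdeals (reducedCStar (univ : Set (Germ ZNat))) (reducedCStar (unitSpace ZNat)) := by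
  classical
  refine ⟨reducedCStar_mono (subset_univ _), fun J hJ hJB => ?_⟩
  refine le_bot_iff.1 fun x hx => ?_
  rw [TwoSidedIdeal.mem_bot]
  by_contra hx0
  obtain ⟨γ, hγ⟩ : ∃ γ, x.1 (lp.single 2 γ (1 : ℂ)) ≠ 0 := by
    by_contra hc
    push Not at hc
    exact hx0 (Subtype.ext (clm_ext_single fun i j => by rw [hc j]; rfl))
  set a := star x * x with ha
  have haJ : a ∈ J := J.mul_mem_left _ _ hx
  set μ : ℝ := ‖x.1 (lp.single 2 γ (1 : ℂ))‖ ^ 2 with hμ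
  have hμ0 : 0 < μ := by positivity
  have haγ : (a.1 (lp.single 2 γ (1 : ℂ)) : L2 ZNat) γ = (μ : ℂ) := star_mul_self_entry x.1 γ
  obtain ⟨A, hA, hγA, hAd⟩ := exists_diagonal_close a.2 γ (ε := μ / 4) (by positivity)
  obtain ⟨B, hB, c, hBA, ⟨p, hp⟩, hBc⟩ := exists_compress_close a.2 (ε := μ / 4) (by positivity) hA
    (onBar_nonempty hA hγA)
  have hpB : (Germ.unit (evalAt p)).tgt.OnBar B := by
    rw [Germ.tgt_unit]; exact (evalAt_onBar hB).2 hp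
  have h1 := hAd _ (onBar_mono hB hA hBA hpB)
  have h2 := (norm_matrix_le _ (Germ.unit (evalAt p)) (Germ.unit (evalAt p))).trans hBc
  rw [compress_entry hpB] at h2
  rw [haγ] at h1
  -- Both `|d - μ|` and `|d - c|` are at most `μ / 4`, where `d` is the diagonal entry of `a` at the
  -- unit over `p ∈ B`. The bound exceeds the error `μ / 4` of the compression, as
  -- `idempotent_mem_of_compress` requires.
  have hc : μ / 2 ≤ ‖c‖ := by
    have h3 : ‖(μ : ℂ)‖ = μ := by rw [Complex.norm_real, Real.norm_of_nonneg hμ0.le]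
    set d := (a.1 (lp.single 2 (Germ.unit (evalAt p)) (1 : ℂ)) : L2 ZNat) (Germ.unit (evalAt p))
    have h4 : (μ : ℂ) = c + (d - c) - (d - μ) := by ring
    have h5 := norm_sub_le (c + (d - c)) (d - μ)
    rw [← h4, h3] at h5
    linarith [norm_add_le c (d - c)]
  have heB : hullOp (HullBar.idem B hB) ∈ reducedCStar (unitSpace ZNat) :=
    hullOp_mem_reducedCStar (bis_idem_subset hB)
  set e : reducedCStar (univ : Set (Germ ZNat)) :=
    ⟨hullOp (HullBar.idem B hB), hullOp_mem_reducedCStar (subset_univ _)⟩ with he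
  have hee : e * e = e := Subtype.ext (idem_mul_idem (hB := hB) (hC := hB) Subset.rfl).1
  have heJ : e ∈ J :=
    J.idempotent_mem_of_compress hJ hee haJ (c := c) (hBc.trans_lt (by linarith))
  have he0 := congrArg Subtype.val (hJB e heJ heB)
  -- The projection fixes the basis vector at the unit over `p ∈ B`, so it is not zero.
  have h6 := idem_single (hB := hB) hpB
  rw [show hullOp (HullBar.idem B hB) = 0 from he0] at h6
  have h7 := congrArg (fun ξ : L2 ZNat => ξ (Germ.unit (evalAt p))) h6
  simp at h7

theorem detectsIdeals_of_le {A B C : NonUnitalStarSubalgebra ℂ (L2 ZNat →L[ℂ] L2 ZNat)}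
    (hCA : C ≤ A) (hBC : B ≤ C) (h : DetectsIdeals A B) : DetectsIdeals A C :=
  ⟨hCA, fun J hJ hJC => h.2 J hJ fun x hx hxB => hJC x hx (hBC hxB)⟩

end ZNat

theorem mainTheorem7 :
    interior (LeftCancellative.Iso ZNat) = LeftCancellative.unitSpace ZNat ∧
    interior (LeftCancellative.Iso ZNat) ⊂ LeftCancellative.unitsAction ZNat ∧
    LeftCancellative.DetectsIdeals
      (LeftCancellative.reducedCStar (Set.univ : Set (LeftCancellative.Germ ZNat)))
      (LeftCancellative.reducedCStar (interior (LeftCancellative.Iso ZNat))) ∧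
    LeftCancellative.DetectsIdeals
      (LeftCancellative.reducedCStar (Set.univ : Set (LeftCancellative.Germ ZNat)))
      (LeftCancellative.reducedCStar (LeftCancellative.unitsAction ZNat)) ∧
    LeftCancellative.reducedCStar (interior (LeftCancellative.Iso ZNat)) <
      LeftCancellative.reducedCStar (LeftCancellative.unitsAction ZNat) := by
  rw [ZNat.interior_iso]
  exact ⟨rfl, ZNat.unitSpace_ssubset_unitsAction, ZNat.detectsIdeals_unitSpace,
    ZNat.detectsIdeals_of_le (LeftCancellative.reducedCStar_mono (subset_univ _))
      (LeftCancellative.reducedCStar_mono ZNat.unitSpace_subset_unitsAction) ZNat.detectsIdeals_unitSpace,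
    ZNat.reducedCStar_unitSpace_lt⟩
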